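/- **Setting.** Let $G$ be a finite group, $\hat G$ the set of (equivalence classes of) complex irreducible representations, $\mathbf 1\in\hat G$ the trivial one, and $d_\mu$, $\chi_\mu(\cdot)$ the dimension and the character of $\mu\in\hat G$. All Hilbert spaces are finite-dimensional. The reduced lattice of the disk with $m$ links (without matter) has one bulk vertex, joined to $m$ boundary vertices by links oriented outwards. Let $\mathcal H_{\mathrm{pre}}=L^2(G)^{\otimes m}$, with basis $|g_1,\dots,g_m\rangle$, let $L_\ell(h)$ be the operator $g_\ell\mapsto hg_\ell$, and let $\mathcal H_m=A\,\mathcal H_{\mathrm{pre}}$, where $A=\frac1{|G|}\sum_{h\in G}\prod_{\ell}L_\ell(h)$ is the Gauss projector. For a set $b$ of links let $\bar b$ be its complement, let $\mathcal A_b\subseteq\mathcal L(\mathcal H_m)$ be the algebra of restrictions to $\mathcal H_m$ of the operators on $\mathcal H_{\mathrm{pre}}$ that act trivially on the links outside $b$ and commute with $A$, and let $$F_{\partial b}(\mu)=\frac{d_\mu}{|G|}\sum_{h\in G}\chi_\mu(h)\prod_{\ell\in b}L_\ell(h)\Big|_{\mathcal H_m}$$ be the projectors onto the sectors of fixed irrep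 flowing out of $b$. **Theorem.** Let $m\ge 4$, let $\mathcal H_\ell$ be a Hilbert space, and let $J:\mathcal H_m\to\mathcal H_\ell^{\otimes m}$ be an isometry. For every $\mu\in\hat G$ let $|\chi_\mu\rangle$ be a vector in a bipartite Hilbert space $\mathcal H_{\mu,l}\otimes\mathcal H_{\mu,r}$ (both depending on $\mu$ only). Suppose: 1. For every set $b$ of links with $b\neq\emptyset\neq\bar b$, $$J|\psi\rangle=\sum_{\mu\in\hat G}F_{\partial b}(\mu)|\psi\rangle\otimes UU'|\chi_\mu\rangle\qquad\text{for all }|\psi\rangle\in\mathcal H_m .$$ That is, there are unitary identifications $F_{\partial b}(\mu)\mathcal H_m\cong P_\mu\otimes P'_\mu$, under which $\mathcal A_b=\bigoplus_\mu\mathcal L(P_\mu)\otimes1$ and $\mathcal A_{\bar b}=\bigoplus_\mu1\otimes\mathcal L(P'_\mu)$, and isometries $U:\bigoplus_\mu P_\mu\otimes\mathcal H_{\mu,l}\to\mathcal H_\ell^{\otimes b}$ and $U':\bigoplus_\mu P'_\mu\otimes\mathcal H_{\mu,r}\to\mathcal H_\ell^{\otimes\bar b}$, such that $J|\psi\rangle=\sum_\mu(U\otimes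 U')\big(F_{\partial b}(\mu)|\psi\rangle\otimes|\chi_\mu\rangle\big)$ for all $|\psi\rangle\in\mathcal H_m$. (In particular $J\mathcal A_bJ^\dagger$ acts on the tensor factor $\mathcal H_\ell^{\otimes b}$.) 2. $|\chi_{\mathbf 1}\rangle$ is a product vector. Then every $|\chi_\mu\rangle$ is maximally entangled of rank $d_\mu$: there are orthonormal vectors $|1\rangle,\dots,|d_\mu\rangle$ in $\mathcal H_{\mu,l}$ and in $\mathcal H_{\mu,r}$ with $$|\chi_\mu\rangle=\frac1{\sqrt{d_\mu}}\sum_{i=1}^{d_\mu}|i\rangle|i\rangle .$$ -/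

import Mathlib

open scoped BigOperators

noncomputable section

/-! ### Irreducible representations of a finite group -/

/-- A complex irreducible matrix representation of `G`. -/
structure IrrepData (G : Type*) [Group G] where
  dim : ℕ
  rep : Representation ℂ G (Fin dim → ℂ)
  irr : rep.IsIrreducible

/-- Equivalence of irreducible representations. -/
instance irrepSetoid (G : Type*) [Group G] : Setoid (IrrepData G) where
  r A B := Nonempty (Representation.Equiv A.rep B.rep)
  iseqv :=
    { refl := fun A => ⟨Representation.Equiv.refl A.rep⟩
      symm := fun ⟨e⟩ => ⟨e.symm⟩
      trans := fun ⟨e⟩ ⟨f⟩ => ⟨e.trans f⟩ }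

/-- The set `Ĝ` of equivalence classes of complex irreducible representations of `G`. -/
def Irrep (G : Type*) [Group G] : Type _ := Quotient (irrepSetoid G)

namespace Irrep

variable {G : Type*} [Group G]

/-- The class of an irreducible representation. -/
def mk (A : IrrepData G) : Irrep G := Quotient.mk (irrepSetoid G) A

/-- The dimension `d_μ` of an irrep. -/
def dim (μ : Irrep G) : ℕ :=
  Quotient.lift (fun A : IrrepData G => A.dim)
    (fun A B h => by
      obtain ⟨e⟩ := h
      simpa using e.toLinearEquiv.finrank_eq) μ

/-- The character of an irrep. -/
def character (μ : Irrep G) : G → ℂ :=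
  Quotient.lift (fun A : IrrepData G => A.rep.character)
    (fun _ _ h => by
      obtain ⟨e⟩ := h
      exact Representation.char_iso e) μ

/-- The trivial irrep `1`. -/
def one (G : Type*) [Group G] : Irrep G :=
  mk
    { dim := 1
      rep := Representation.trivial ℂ G (Fin 1 → ℂ)
      irr := by
        have : IsSimpleModule ℂ (Fin 1 → ℂ) :=
          (isSimpleModule_iff_finrank_eq_one (R := ℂ)).2 (by simp)
        have key : ∀ S : Subrepresentation (Representation.trivial ℂ G (Fin 1 → ℂ)),
            S = ⊥ ∨ S = ⊤ := by
          intro S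
          rcases eq_bot_or_eq_top S.toSubmodule with h | h
          · exact Or.inl (Subrepresentation.toSubmodule_injective h)
          · exact Or.inr (Subrepresentation.toSubmodule_injective h)
        have : Nontrivial
            (Subrepresentation (Representation.trivial ℂ G (Fin 1 → ℂ))) := by
          refine ⟨⊥, ⊤, fun h => ?_⟩
          have h' := congrArg Subrepresentation.toSubmodule h
          exact bot_ne_top (α := Submodule ℂ (Fin 1 → ℂ)) h'
        exact ⟨key⟩ }

theorem character_conj (μ : Irrep G) (g h : G) :
    μ.character (h * g * h⁻¹) = μ.character g := by
  obtain ⟨A, rfl⟩ : ∃ A, mk A = μ := Quotient.exists_rep μ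
  exact A.rep.char_conj g h

theorem character_linearIndependent [Fintype G] :
    LinearIndependent ℂ (fun μ : Irrep G => μ.character) := by
  classical
  let _ : Invertible (Nat.card G : ℂ) := invertibleOfNonzero (by simp)
  let φ : Irrep G → (G → ℂ) →ₗ[ℂ] ℂ := fun μ =>
    (Nat.card G : ℂ)⁻¹ • ∑ g : G, μ.character g⁻¹ • LinearMap.proj g
  have hφ : ∀ μ ν : Irrep G, φ μ ν.character = if ν = μ then 1 else 0 := by
    intro μ ν
    obtain ⟨A, rfl⟩ : ∃ A, mk A = μ := Quotient.exists_rep μ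
    obtain ⟨B, rfl⟩ : ∃ B, mk B = ν := Quotient.exists_rep ν
    have := A.irr
    have := B.irr
    have e : Nonempty (Representation.Equiv A.rep B.rep) ↔ mk B = mk A :=
      ⟨fun h => (Quotient.sound h).symm, fun h => Quotient.exact h.symm⟩
    have h2 : φ (mk A) (mk B).character =
        (Nat.card G : ℂ)⁻¹ * ∑ g : G, B.rep.character g * A.rep.character g⁻¹ := by
      have hA : (mk A).character = A.rep.character := rfl
      have hB : (mk B).character = B.rep.character := rfl
      simp [φ, hA, hB, mul_comm]
    rw [h2, Representation.char_orthonormal B.rep A.rep]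
    by_cases hAB : mk B = mk A
    · rw [if_pos (e.2 hAB), if_pos hAB]
    · rw [if_neg (fun h => hAB (e.1 h)), if_neg hAB]
  rw [linearIndependent_iff']
  intro s c hc μ hμ
  have := congrArg (φ μ) hc
  simpa [map_sum, hφ, hμ] using this

instance [Fintype G] : Finite (Irrep G) :=
  (character_linearIndependent (G := G)).finite

instance [Fintype G] : Fintype (Irrep G) := Fintype.ofFinite _

end Irrep

/-! ### Tensor powers of a finite-dimensional Hilbert space

A finite-dimensional Hilbert space with an orthonormal basis indexed by `κ` is
`EuclideanSpace ℂ κ`; its tensor power over a finite set `L` of links has the product basis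
indexed by `L → κ`. -/

/-- `H^{⊗ m}` for `H = EuclideanSpace ℂ κ`; the tensor factors (links) are labelled by `Fin m`. -/
abbrev LinkSpace (m : ℕ) (κ : Type*) [Fintype κ] : Type _ :=
  EuclideanSpace ℂ (Fin m → κ)

/-- The tensor factor `H_b = ⨂_{ℓ ∈ b} H` belonging to a set `b` of links. -/
abbrev RegionSpace {m : ℕ} (b : Finset (Fin m)) (κ : Type*) [Fintype κ] : Type _ :=
  EuclideanSpace ℂ (b → κ)

/-- `u ⊗ v ∈ H_b ⊗ H_{bᶜ} = H^{⊗ m}`. -/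
def tensorVec {m : ℕ} {κ : Type*} [Fintype κ] (b : Finset (Fin m))
    (u : RegionSpace b κ) (v : RegionSpace bᶜ κ) : LinkSpace m κ :=
  WithLp.toLp 2 fun z => u (fun ℓ => z ℓ) * v (fun ℓ => z ℓ)

/-- The configuration equal to `x` on `b` and to `z` outside `b`. -/
def overwrite {m : ℕ} {κ : Type*} (b : Finset (Fin m)) (x : b → κ) (z : Fin m → κ) :
    Fin m → κ :=
  fun ℓ => if h : ℓ ∈ b then x ⟨ℓ, h⟩ else z ℓ

/-- The operator `Y ⊗ 1` on `H_b ⊗ H_{bᶜ} = H^{⊗ m}`. -/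
def localOp {m : ℕ} {κ : Type*} [Fintype κ] (b : Finset (Fin m))
    (Y : Module.End ℂ (RegionSpace b κ)) : Module.End ℂ (LinkSpace m κ) where
  toFun ψ := WithLp.toLp 2 fun z =>
    Y (WithLp.toLp 2 fun x => ψ (overwrite b x z)) (fun ℓ => z ℓ)
  map_add' ψ φ := by
    ext z
    have : (WithLp.toLp 2 fun x => (ψ + φ) (overwrite b x z) : RegionSpace b κ) =
        (WithLp.toLp 2 fun x => ψ (overwrite b x z)) +
          (WithLp.toLp 2 fun x => φ (overwrite b x z)) := by
      ext x; simp
    change Y _ _ = _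
    rw [this, map_add]
    rfl
  map_smul' c ψ := by
    ext z
    have : (WithLp.toLp 2 fun x => (c • ψ) (overwrite b x z) : RegionSpace b κ) =
        c • (WithLp.toLp 2 fun x => ψ (overwrite b x z)) := by
      ext x; simp
    change Y _ _ = _
    rw [this, map_smul]
    rfl

/-! ### The doubly gauged model on the reduced lattice of the disk, without matter

The lattice has one bulk vertex, `m` boundary vertices and `m` links (labelled by `Fin m`) from
the bulk vertex to the boundary vertices, all oriented outwards. There are no bulk plaquettes,
so the only constraint is Gauss's law at the bulk vertex. The pre-gauged space is
`L²(G)^{⊗ m} = LinkSpace m G`; a vector `ψ` is `∑_g ψ(g) |g_1, …, g_m⟩`. -/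

section Model

variable {G : Type*} [Group G] [Fintype G] {m : ℕ}

/-- `∏_{ℓ ∈ b} L_ℓ(h)`: the operator `|g⟩ ↦ |g'⟩` with `g'_ℓ = h g_ℓ` for `ℓ ∈ b` and
`g'_ℓ = g_ℓ` otherwise. -/
def shift (b : Finset (Fin m)) (h : G) : Module.End ℂ (LinkSpace m G) where
  toFun ψ := WithLp.toLp 2 fun g => ψ fun ℓ => if ℓ ∈ b then h⁻¹ * g ℓ else g ℓ
  map_add' _ _ := by ext; simp
  map_smul' _ _ := by ext; simp

variable (G m) in
/-- The projector `A = |G|⁻¹ ∑_g A_v(g)` onto the solutions of Gauss's law at the bulk vertex. -/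
def gaussProj : Module.End ℂ (LinkSpace m G) :=
  (Fintype.card G : ℂ)⁻¹ • ∑ h : G, shift Finset.univ h

variable (G m) in
/-- The physical Hilbert space `H_m`. -/
def physical : Submodule ℂ (LinkSpace m G) := LinearMap.range (gaussProj G m)

/-- The operator `(d_μ / |G|) ∑_h χ_μ(h) ∏_{ℓ ∈ b} L_ℓ(h)` on the pre-gauged space. -/
def fluxPre (b : Finset (Fin m)) (μ : Irrep G) : Module.End ℂ (LinkSpace m G) :=
  ((μ.dim : ℂ) / (Fintype.card G : ℂ)) • ∑ h : G, μ.character h • shift b h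

theorem shift_mul_shift_univ (b : Finset (Fin m)) (h k : G) :
    shift b h * shift Finset.univ k = shift Finset.univ k * shift b (k⁻¹ * h * k) := by
  ext ψ g
  simp only [shift, Module.End.mul_apply, LinearMap.coe_mk, AddHom.coe_mk, Finset.mem_univ,
    if_true]
  refine congrArg ψ (funext fun ℓ => ?_)
  split_ifs <;> group

theorem fluxPre_commute (b : Finset (Fin m)) (μ : Irrep G) :
    fluxPre b μ * gaussProj G m = gaussProj G m * fluxPre b μ := by
  have key : (∑ h : G, μ.character h • shift b h) * (∑ k : G, shift (m := m) Finset.univ k) =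
      (∑ k : G, shift Finset.univ k) * ∑ h : G, μ.character h • shift b h := by
    rw [Finset.mul_sum, Finset.sum_mul]
    refine Finset.sum_congr rfl fun k _ => ?_
    rw [Finset.sum_mul, Finset.mul_sum]
    rw [← Equiv.sum_comp (MulAut.conj k⁻¹).toEquiv
      (fun h => shift (m := m) Finset.univ k * μ.character h • shift b h)]
    refine Finset.sum_congr rfl fun h _ => ?_
    have e : (MulAut.conj k⁻¹).toEquiv h = k⁻¹ * h * k := by simp
    have c : μ.character (k⁻¹ * h * k) = μ.character h := by
      simpa using μ.character_conj h k⁻¹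
    rw [e, c, smul_mul_assoc, mul_smul_comm, shift_mul_shift_univ]
  simp only [fluxPre, gaussProj, smul_mul_assoc, mul_smul_comm, key]
  rw [smul_comm]

/-- The central projector `F_{∂b}(μ)` on `H_m`, measuring the irrep flowing out of `b`. -/
def flux (b : Finset (Fin m)) (μ : Irrep G) : Module.End ℂ (physical G m) :=
  (fluxPre b μ).restrict (by
    rintro _ ⟨φ, rfl⟩
    exact ⟨fluxPre b μ φ, (LinearMap.congr_fun (fluxPre_commute b μ) φ).symm⟩)

/-- The algebra `A_b` of physical operators of the region `b`: the restrictions to `H_m` of the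
operators on the pre-gauged space which act trivially on the links outside `b` and commute with
the Gauss projector. -/
def regionAlgebra (b : Finset (Fin m)) : Set (Module.End ℂ (physical G m)) :=
  {X | ∃ Y : Module.End ℂ (RegionSpace b G), Commute (localOp b Y) (gaussProj G m) ∧
    ∀ ψ : physical G m, (X ψ : LinkSpace m G) = localOp b Y ψ}

/-- An identification of every sector `F_{∂b}(μ) H_m` with a tensor product `P_μ ⊗ P'_μ` of
Hilbert spaces under which `A_b = ⨁_μ L(P_μ) ⊗ 1` and `A_{bᶜ} = ⨁_μ 1 ⊗ L(P'_μ)`. It is given by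
the orthonormal basis `e μ (a, a')` of the sector that corresponds to the product of
orthonormal bases of `P_μ` and `P'_μ`. -/
structure SectorSplitting (G : Type*) [Group G] [Fintype G] {m : ℕ} (b : Finset (Fin m)) where
  /-- dimension of `P_μ` -/
  k : Irrep G → ℕ
  /-- dimension of `P'_μ` -/
  k' : Irrep G → ℕ
  e : (μ : Irrep G) → Fin (k μ) × Fin (k' μ) → physical G m
  orthonormal : ∀ μ, Orthonormal ℂ (e μ)
  span_eq : ∀ μ, Submodule.span ℂ (Set.range (e μ)) = LinearMap.range (flux b μ)
  mem_regionAlgebra : ∀ X : Module.End ℂ (physical G m), X ∈ regionAlgebra b ↔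
    ∃ Y : (μ : Irrep G) → Matrix (Fin (k μ)) (Fin (k μ)) ℂ,
      ∀ μ a a', X (e μ (a, a')) = ∑ c, Y μ c a • e μ (c, a')
  mem_regionAlgebra_compl : ∀ X : Module.End ℂ (physical G m), X ∈ regionAlgebra bᶜ ↔
    ∃ Y : (μ : Irrep G) → Matrix (Fin (k' μ)) (Fin (k' μ)) ℂ,
      ∀ μ a a', X (e μ (a, a')) = ∑ c, Y μ c a' • e μ (a, c)

/-- `J ψ = ∑_μ F_{∂b}(μ) ψ ⊗ U U' χ_μ`, where `χ_μ` is a vector of the auxiliary space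
`EuclideanSpace ℂ (α μ) ⊗ EuclideanSpace ℂ (β μ)`. The isometry `U` embeds the Hilbert space
`⨁_μ P_μ ⊗ EuclideanSpace ℂ (α μ)` into `H_b`, and `U'` embeds
`⨁_μ P'_μ ⊗ EuclideanSpace ℂ (β μ)` into `H_{bᶜ}`; they are given by the orthonormal images `w`
and `w'` of the product bases. In particular `J X J†`, for `X ∈ A_b`, acts on the factor `H_b`. -/
def HasEdgeModes {κ : Type*} [Fintype κ] {α β : Irrep G → Type*}
    [∀ μ, Fintype (α μ)] [∀ μ, Fintype (β μ)]
    (J : physical G m →ₗᵢ[ℂ] LinkSpace m κ) (b : Finset (Fin m))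
    (χ : (μ : Irrep G) → EuclideanSpace ℂ (α μ × β μ)) : Prop :=
  ∃ (S : SectorSplitting G b)
    (w : (Σ μ : Irrep G, Fin (S.k μ) × α μ) → RegionSpace b κ)
    (w' : (Σ μ : Irrep G, Fin (S.k' μ) × β μ) → RegionSpace bᶜ κ),
    Orthonormal ℂ w ∧ Orthonormal ℂ w' ∧
    ∀ ψ : physical G m,
      J ψ = ∑ μ, ∑ a, ∑ a', inner ℂ (S.e μ (a, a')) (flux b μ ψ) •
        ∑ i, ∑ j, χ μ (i, j) • tensorVec b (w ⟨μ, a, i⟩) (w' ⟨μ, a', j⟩)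

end Model

/-- A vector of `EuclideanSpace ℂ α ⊗ EuclideanSpace ℂ β` is factorized (a product vector). -/
def IsFactorized {α β : Type*} [Fintype α] [Fintype β] (χ : EuclideanSpace ℂ (α × β)) : Prop :=
  ∃ (u : EuclideanSpace ℂ α) (v : EuclideanSpace ℂ β), ∀ i j, χ (i, j) = u i * v j

/-- `χ = d^{-1/2} ∑_{r=1}^{d} |r⟩|r⟩` for orthonormal vectors `|1⟩, …, |d⟩` in each of the two
factors. -/
def IsMaximallyEntangledOfRank {α β : Type*} [Fintype α] [Fintype β]
    (χ : EuclideanSpace ℂ (α × β)) (d : ℕ) : Prop :=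
  ∃ (e : Fin d → EuclideanSpace ℂ α) (f : Fin d → EuclideanSpace ℂ β),
    Orthonormal ℂ e ∧ Orthonormal ℂ f ∧
    ∀ i j, χ (i, j) = ((Real.sqrt d : ℝ) : ℂ)⁻¹ * ∑ r, e r i * f r j

end

open scoped BigOperators

noncomputable section

open scoped Matrix

/-! ### Schur's lemma and character identities -/

namespace IrrepData

variable {G : Type*} [Group G]

/-! Write `n = |G|`, let `X_μ` be the coefficient matrix of `χ_μ`, and put `ρ_μ = X_μ X_μ†`. The
claim is that `ρ_μ` has trace one and `1/d_μ` as its only nonzero eigenvalue. The argument tests `J`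
on a single state and compares different cuts of it.

Let `p` consist of two links, and let `ψ` be `n⁻¹ ∑_{s,t}` of the configurations equal to `s` on `p`
and to `t` off `p`. This state is a product across `p | pᶜ` and carries only trivial flux out of
`p`. Since `χ_1` is a product vector, `J ψ` is a product across the same cut
(`exists_map_eq_tensorVec`). So for `i ∈ p` and `j ∉ p`, the traces of powers of the reduced states
of `J ψ` multiply: the one on `{i, j}` is the product of those on `{i}` and `{j}`.

Each of `b = {i}, {j}, {i, j}` also gives a cut. As both halves of the lattice keep a link outside
`b`, `ψ` is maximally mixed on `b`. Then every `P_μ` is maximally mixed, with weights fixed by group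
theory: a minimal projection of the commutant of the translations, inside the `μ` sector, has rank
`d_μ` (`trace_minimal`, `coeff_mul_conjTranspose`). With `N = n^|b|`, the `r`-th moment of `J ψ` on
`b` is `S_r / (n N^(r-1))`, where `S_r = ∑ d_μ^(r+1) tr ρ_μ^r` does not depend on `b`
(`moments_of_isMaximallyMixed`).

Multiplicativity now reads `S_r² = n S_r` for `r = 2, 3`, and normalization of `J ψ` gives `S_1 =
n`. Positivity excludes zero, so `S_1 = S_2 = S_3 = n`. Hence `∑ d_μ² tr(ρ_μ (d_μ ρ_μ - 1)²) = S_3 -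
2 S_2 + S_1 = 0`. All terms are nonnegative, so all vanish, and `d_μ ρ_μ` is a projection
(`flat_of_moments`). Its trace is `d_μ`, because `J` preserves the norm of a vector in each sector.
-/

theorem dim_pos (A : IrrepData G) : 0 < A.dim := by
  rcases Nat.eq_zero_or_pos A.dim with h | h
  · exfalso
    have := A.irr
    obtain ⟨S, T, hST⟩ := exists_pair_ne (Subrepresentation A.rep)
    apply hST
    apply Subrepresentation.toSubmodule_injective
    have : Subsingleton (Fin A.dim → ℂ) := by rw [h]; infer_instance
    exact Subsingleton.elim _ _
  · exact h

theorem exists_eq_smul_one_of_commute (A : IrrepData G) (L : Module.End ℂ (Fin A.dim → ℂ))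
    (hL : ∀ g, A.rep g * L = L * A.rep g) : ∃ c : ℂ, L = c • 1 := by
  have := A.irr
  let f : Representation.IntertwiningMap A.rep A.rep :=
    { toLinearMap := L
      isIntertwining' := fun g => (hL g).symm }
  obtain ⟨c, hc⟩ :=
    (Representation.IsIrreducible.algebraMap_intertwiningMap_bijective_of_isAlgClosed
      (ρ := A.rep)).2 f
  refine ⟨c, ?_⟩
  have h := congrArg (fun F : Representation.IntertwiningMap A.rep A.rep => F.toLinearMap) hc
  exact h.symm

/-- Schur's lemma in the form of a trace identity. -/
theorem trace_mul_of_commute (A : IrrepData G) (L : Module.End ℂ (Fin A.dim → ℂ))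
    (hL : ∀ g, A.rep g * L = L * A.rep g) (M : Module.End ℂ (Fin A.dim → ℂ)) :
    (A.dim : ℂ) * LinearMap.trace ℂ _ (L * M) =
      LinearMap.trace ℂ _ L * LinearMap.trace ℂ _ M := by
  obtain ⟨c, rfl⟩ := A.exists_eq_smul_one_of_commute L hL
  simp
  ring

end IrrepData

namespace Irrep

variable {G : Type*} [Group G]

theorem exists_mk_eq (μ : Irrep G) : ∃ A, mk A = μ := Quotient.exists_rep μ

theorem dim_pos (μ : Irrep G) : 0 < μ.dim := by
  obtain ⟨A, rfl⟩ := μ.exists_mk_eq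
  exact A.dim_pos

theorem dim_ne_zero (μ : Irrep G) : (μ.dim : ℂ) ≠ 0 := by
  exact_mod_cast μ.dim_pos.ne'

theorem character_one (μ : Irrep G) : μ.character 1 = μ.dim := by
  obtain ⟨A, rfl⟩ := μ.exists_mk_eq
  change A.rep.character 1 = A.dim
  simp

theorem character_trivial (g : G) : (one G).character g = 1 := by
  change (Representation.trivial ℂ G (Fin 1 → ℂ)).character g = 1
  simp [Representation.character]

variable [Fintype G]

theorem card_ne_zero : (Fintype.card G : ℂ) ≠ 0 := by simp

open scoped Classical in
theorem sum_character_mul_inv (μ ν : Irrep G) :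
    ∑ g, μ.character g * ν.character g⁻¹ = if μ = ν then (Fintype.card G : ℂ) else 0 := by
  obtain ⟨A, rfl⟩ := μ.exists_mk_eq
  obtain ⟨B, rfl⟩ := ν.exists_mk_eq
  let _ : Invertible (Nat.card G : ℂ) := invertibleOfNonzero (by simp)
  have := A.irr
  have := B.irr
  have e : Nonempty (Representation.Equiv B.rep A.rep) ↔ mk A = mk B :=
    ⟨fun h => (Quotient.sound h).symm, fun h => Quotient.exact h.symm⟩
  have h := Representation.char_orthonormal A.rep B.rep
  rw [inv_mul_eq_iff_eq_mul₀ (by simp)] at h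
  change ∑ g, A.rep.character g * B.rep.character g⁻¹ = _
  rw [h]
  by_cases hAB : mk A = mk B
  · simp [if_pos (e.2 hAB), hAB]
  · simp [hAB, e]

-- The class-function average `∑ χ_μ(h) ν(h⁻¹)` is a scalar by Schur, and its trace is given by
-- orthogonality. This is what makes the isotypic operators orthogonal idempotents.
open scoped Classical in
theorem sum_character_mul_character (μ ν : Irrep G) (g : G) :
    (μ.dim : ℂ) * ∑ h, μ.character h * ν.character (h⁻¹ * g) =
      if μ = ν then (Fintype.card G : ℂ) * μ.character g else 0 := by
  obtain ⟨B, hB⟩ := ν.exists_mk_eq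
  have hχ : ∀ x, ν.character x = LinearMap.trace ℂ _ (B.rep x) := by subst hB; exact fun _ => rfl
  have key := B.trace_mul_of_commute (∑ h, μ.character h • B.rep h⁻¹) (fun k => by
    rw [Finset.mul_sum, Finset.sum_mul]
    refine Fintype.sum_equiv (MulAut.conj k).toEquiv _ _ fun h => ?_
    have e : (MulAut.conj k).toEquiv h = k * h * k⁻¹ := rfl
    rw [e, character_conj, mul_smul_comm, smul_mul_assoc, ← map_mul, ← map_mul]
    congr 2
    group) (B.rep g)
  simp only [Finset.sum_mul, map_sum, smul_mul_assoc, ← map_mul, map_smul, ← hχ,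
    smul_eq_mul] at key
  rw [← Finset.sum_mul, sum_character_mul_inv] at key
  have hd : (ν.dim : ℂ) = B.dim := by subst hB; rfl
  rw [← hd] at key
  split_ifs at key ⊢ with h
  · subst h; exact key
  · rw [zero_mul, mul_eq_zero] at key
    rw [key.resolve_left ν.dim_ne_zero, mul_zero]

/-- Averaging `g` over its conjugates gives an intertwiner, hence a scalar determined by its trace.
-/
theorem sum_character_conj_mul (μ : Irrep G) (g l : G) :
    (μ.dim : ℂ) * ∑ k, μ.character (k * g * k⁻¹ * l) =
      (Fintype.card G : ℂ) * (μ.character g * μ.character l) := by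
  obtain ⟨B, rfl⟩ := μ.exists_mk_eq
  have key := B.trace_mul_of_commute (∑ k, B.rep (k * g * k⁻¹)) (fun x => by
    rw [Finset.mul_sum, Finset.sum_mul]
    refine Fintype.sum_equiv (Equiv.mulLeft x) _ _ fun k => ?_
    rw [← map_mul, ← map_mul]
    congr 1
    simp only [Equiv.coe_mulLeft]
    group) (B.rep l)
  rw [Finset.sum_mul, map_sum, map_sum] at key
  simp_rw [← map_mul] at key
  change (B.dim : ℂ) * ∑ k, B.rep.character (k * g * k⁻¹ * l) =
    (∑ k, B.rep.character (k * g * k⁻¹)) * B.rep.character l at key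
  simp only [Representation.char_conj, Finset.sum_const, Finset.card_univ, nsmul_eq_mul] at key
  change (B.dim : ℂ) * ∑ k, B.rep.character (k * g * k⁻¹ * l) = _
  rw [key]
  change _ = _ * (B.rep.character g * B.rep.character l)
  ring

-- Unitarian trick: `P = ∑ R(x)† R(x)` is positive definite and invariant, so `R(g⁻¹) = P⁻¹ R(g)†
-- P`, which has the trace of `R(g)†`.
open scoped Matrix ComplexOrder in
theorem character_inv (μ : Irrep G) (g : G) : μ.character g⁻¹ = star (μ.character g) := by
  obtain ⟨B, rfl⟩ := μ.exists_mk_eq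
  let R : G → Matrix (Fin B.dim) (Fin B.dim) ℂ := fun x => LinearMap.toMatrix' (B.rep x)
  have hmul : ∀ x y, R (x * y) = R x * R y := fun x y => by
    simp [R, LinearMap.toMatrix'_mul]
  have hone : R 1 = 1 := by simp [R]
  have htr : ∀ x, (mk B).character x = (R x).trace := fun x => by
    change LinearMap.trace ℂ _ (B.rep x) = _
    rw [LinearMap.trace_eq_matrix_trace ℂ (Pi.basisFun ℂ _), LinearMap.toMatrix_eq_toMatrix']
  let P := ∑ x, (R x)ᴴ * R x
  have hP : P.PosDef := by
    classical
    have : P = 1 + ∑ x ∈ Finset.univ.erase 1, (R x)ᴴ * R x := by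
      rw [show P = ∑ x, (R x)ᴴ * R x from rfl,
        ← Finset.add_sum_erase _ _ (Finset.mem_univ (1 : G)), hone]
      simp
    rw [this]
    exact Matrix.PosDef.one.add_posSemidef
      (Matrix.posSemidef_sum _ fun x _ => Matrix.posSemidef_conjTranspose_mul_self _)
  have hinv : (R g)ᴴ * P * R g = P := by
    simp only [P, Finset.mul_sum, Finset.sum_mul]
    refine Fintype.sum_equiv (Equiv.mulRight g) _ _ fun x => ?_
    simp [hmul, Matrix.conjTranspose_mul, Matrix.mul_assoc]
  have hU : IsUnit P := hP.isUnit
  have hdet : IsUnit P.det := (Matrix.isUnit_iff_isUnit_det P).1 hU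
  have h2 : P * R g⁻¹ = (R g)ᴴ * P := by
    calc P * R g⁻¹ = (R g)ᴴ * P * (R g * R g⁻¹) := by rw [← Matrix.mul_assoc, hinv]
      _ = _ := by rw [← hmul, mul_inv_cancel, hone, Matrix.mul_one]
  have h3 : R g⁻¹ = P⁻¹ * ((R g)ᴴ * P) := by
    rw [← h2, Matrix.nonsing_inv_mul_cancel_left _ _ hdet]
  rw [htr, htr, h3, Matrix.trace_mul_comm, Matrix.mul_assoc, Matrix.mul_nonsing_inv _ hdet,
    Matrix.mul_one, Matrix.trace_conjTranspose]

end Irrep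

/-! ### Vectors of `H_b ⊗ H_{bᶜ}` as matrices -/

section Bipartite

variable {m : ℕ} {κ : Type*}

/-- The configuration equal to `x` on `b` and to `z` on `bᶜ`. -/
def glue (b : Finset (Fin m)) (x : b → κ) (z : ↥bᶜ → κ) : Fin m → κ :=
  fun ℓ => if h : ℓ ∈ b then x ⟨ℓ, h⟩ else z ⟨ℓ, Finset.mem_compl.2 h⟩

theorem glue_left (b : Finset (Fin m)) (x : b → κ) (z : ↥bᶜ → κ) :
    (fun ℓ : b => glue b x z ℓ) = x := by
  funext ℓ; simp [glue]

theorem glue_right (b : Finset (Fin m)) (x : b → κ) (z : ↥bᶜ → κ) :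
    (fun ℓ : ↥bᶜ => glue b x z ℓ) = z := by
  funext ℓ
  have := Finset.mem_compl.1 ℓ.2
  simp [glue, this]

theorem glue_restrict (b : Finset (Fin m)) (g : Fin m → κ) :
    glue b (fun ℓ => g ℓ) (fun ℓ => g ℓ) = g := by
  funext ℓ; simp [glue]

/-- A configuration is a pair of configurations of `b` and of `bᶜ`. -/
def glueEquiv (b : Finset (Fin m)) : (b → κ) × (↥bᶜ → κ) ≃ (Fin m → κ) where
  toFun q := glue b q.1 q.2
  invFun g := (fun ℓ => g ℓ, fun ℓ => g ℓ)
  left_inv _ := Prod.ext (glue_left b _ _) (glue_right b _ _)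
  right_inv g := glue_restrict b g

variable [Fintype κ]

/-- The vector `Ψ` of `H_b ⊗ H_{bᶜ}` as a matrix. -/
def bipartite (b : Finset (Fin m)) : LinkSpace m κ →ₗ[ℂ] Matrix (b → κ) (↥bᶜ → κ) ℂ where
  toFun Ψ := Matrix.of fun x z => Ψ (glue b x z)
  map_add' _ _ := by ext; simp
  map_smul' _ _ := by ext; simp

theorem bipartite_apply (b : Finset (Fin m)) (Ψ : LinkSpace m κ) (x : b → κ) (z : ↥bᶜ → κ) :
    bipartite b Ψ x z = Ψ (glue b x z) := rfl

theorem bipartite_injective (b : Finset (Fin m)) :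
    Function.Injective (bipartite (κ := κ) b) := by
  intro Ψ Φ h
  ext g
  have := congrFun (congrFun h fun ℓ => g ℓ) fun ℓ => g ℓ
  simpa only [bipartite_apply, glue_restrict] using this

theorem inner_eq_trace (b : Finset (Fin m)) (Φ Ψ : LinkSpace m κ) :
    inner ℂ Φ Ψ = (bipartite b Ψ * (bipartite b Φ)ᴴ).trace := by
  simp only [PiLp.inner_apply, RCLike.inner_apply, Matrix.trace, Matrix.diag, Matrix.mul_apply,
    Matrix.conjTranspose_apply, bipartite_apply]
  rw [← Equiv.sum_comp (glueEquiv b), Fintype.sum_prod_type]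
  rfl

theorem bipartite_tensorVec (b : Finset (Fin m)) (u : RegionSpace b κ) (v : RegionSpace bᶜ κ) :
    bipartite b (tensorVec b u v) = Matrix.vecMulVec u v := by
  ext x z
  simp only [bipartite_apply, tensorVec, glue_left, glue_right, Matrix.vecMulVec_apply]

theorem bipartite_localOp [DecidableEq κ] (b : Finset (Fin m)) (A : Matrix (b → κ) (b → κ) ℂ)
    (Ψ : LinkSpace m κ) :
    bipartite b (localOp b (Matrix.toEuclideanLin A) Ψ) = A * bipartite b Ψ := by
  ext x z
  simp only [bipartite_apply, localOp, LinearMap.coe_mk, AddHom.coe_mk, glue_left,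
    Matrix.mul_apply, Matrix.toLpLin_apply, Matrix.mulVec, dotProduct]
  refine Finset.sum_congr rfl fun y _ => ?_
  refine congrArg (fun g => A x y * Ψ g) (funext fun ℓ => ?_)
  simp only [overwrite, glue]
  split_ifs <;> rfl

theorem bipartite_localOp_compl [DecidableEq κ] (b : Finset (Fin m)) (A : Matrix (↥bᶜ → κ) (↥bᶜ → κ) ℂ)
    (Ψ : LinkSpace m κ) :
    bipartite b (localOp bᶜ (Matrix.toEuclideanLin A) Ψ) = bipartite b Ψ * Aᵀ := by
  ext x z
  simp only [bipartite_apply, localOp, LinearMap.coe_mk, AddHom.coe_mk, glue_right,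
    Matrix.mul_apply, Matrix.toLpLin_apply, Matrix.mulVec, dotProduct, Matrix.transpose_apply]
  refine Finset.sum_congr rfl fun y _ => ?_
  rw [mul_comm]
  refine congrArg (fun g => Ψ g * A z y) (funext fun ℓ => ?_)
  simp only [overwrite, glue, Finset.mem_compl]
  split_ifs <;> rfl

end Bipartite

/-! ### Moments of reduced states and their multiplicativity -/

section Moments

variable {L κ : Type*}

open scoped Classical in
/-- The configuration equal to `x` where `p` holds and to `z` elsewhere. -/
def mix (p : L → Prop) (x z : L → κ) : L → κ := fun ℓ => if p ℓ then x ℓ else z ℓ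

variable [Fintype L] [DecidableEq L] [Fintype κ]

/-- The trace of the square of the reduced density matrix of `Ψ` on the tensor factors in `p`. -/
def secondMoment (p : L → Prop) (Ψ : (L → κ) → ℂ) : ℂ :=
  ∑ q : (L → κ) × (L → κ), Ψ q.1 * star (Ψ (mix p q.2 q.1)) *
    (Ψ q.2 * star (Ψ (mix p q.1 q.2)))

/-- The trace of the cube of the reduced density matrix of `Ψ` on the tensor factors in `p`. -/
def thirdMoment (p : L → Prop) (Ψ : (L → κ) → ℂ) : ℂ :=
  ∑ q : (L → κ) × (L → κ) × (L → κ), Ψ q.1 * star (Ψ (mix p q.2.1 q.1)) *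
    (Ψ q.2.1 * star (Ψ (mix p q.2.2 q.2.1))) * (Ψ q.2.2 * star (Ψ (mix p q.1 q.2.2)))

end Moments

section MomentLemmas

variable {m : ℕ} {κ : Type*}

theorem mix_glue (b : Finset (Fin m)) (x y : b → κ) (z t : ↥bᶜ → κ) :
    mix (· ∈ b) (glue b x z) (glue b y t) = glue b x t := by
  funext ℓ
  simp only [mix, glue]
  split_ifs <;> rfl

theorem mix_restrict {L : Type*} (q : Finset L) (p : L → Prop) (g h : L → κ) :
    (fun ℓ : q => mix p g h ℓ) = mix (fun ℓ : q => p ℓ) (fun ℓ => g ℓ) (fun ℓ => h ℓ) := by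
  funext ℓ
  simp only [mix]

theorem mix_false {L : Type*} (x z : L → κ) : mix (fun _ => False) x z = z := by
  funext ℓ; simp [mix]

variable [Fintype κ]

/-- Pairs of configurations as pairs of configurations of `b` and of `bᶜ`. -/
def glueEquivPair (b : Finset (Fin m)) :
    ((b → κ) × (b → κ)) × ((↥bᶜ → κ) × (↥bᶜ → κ)) ≃ (Fin m → κ) × (Fin m → κ) :=
  (Equiv.prodProdProdComm _ _ _ _).trans ((glueEquiv b).prodCongr (glueEquiv b))

/-- Triples of configurations as pairs of triples of configurations of `b` and of `bᶜ`. -/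
def glueEquivTriple (b : Finset (Fin m)) :
    ((b → κ) × (b → κ) × (b → κ)) × ((↥bᶜ → κ) × (↥bᶜ → κ) × (↥bᶜ → κ)) ≃
      (Fin m → κ) × (Fin m → κ) × (Fin m → κ) :=
  (Equiv.prodProdProdComm _ _ _ _).trans ((glueEquiv b).prodCongr (glueEquivPair b))

/-- Replica form of the trace: two copies of `Ψ` are contracted with two conjugate copies whose `b`
parts are exchanged. In this form the cut `b` enters only through `mix`, so it can be compared with
a factorization of `Ψ` along another cut. -/
theorem trace_sq_eq_secondMoment (b : Finset (Fin m)) (Ψ : LinkSpace m κ) :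
    (bipartite b Ψ * (bipartite b Ψ)ᴴ * (bipartite b Ψ * (bipartite b Ψ)ᴴ)).trace =
      secondMoment (· ∈ b) Ψ := by
  rw [secondMoment, ← Equiv.sum_comp (glueEquivPair b), Fintype.sum_prod_type,
    Fintype.sum_prod_type, Matrix.trace]
  refine Finset.sum_congr rfl fun x _ => ?_
  rw [Matrix.diag, Matrix.mul_apply]
  refine Finset.sum_congr rfl fun y _ => ?_
  rw [Fintype.sum_prod_type, Matrix.mul_apply, Matrix.mul_apply, Finset.sum_mul_sum]
  refine Finset.sum_congr rfl fun z _ => Finset.sum_congr rfl fun t _ => ?_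
  change _ = Ψ (glue b x z) * star (Ψ (mix _ (glue b y t) (glue b x z))) *
    (Ψ (glue b y t) * star (Ψ (mix _ (glue b x z) (glue b y t))))
  rw [mix_glue, mix_glue]
  rfl

theorem trace_cube_eq_thirdMoment (b : Finset (Fin m)) (Ψ : LinkSpace m κ) :
    (bipartite b Ψ * (bipartite b Ψ)ᴴ * (bipartite b Ψ * (bipartite b Ψ)ᴴ) *
      (bipartite b Ψ * (bipartite b Ψ)ᴴ)).trace =
      thirdMoment (· ∈ b) Ψ := by
  rw [thirdMoment, ← Equiv.sum_comp (glueEquivTriple b), Fintype.sum_prod_type,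
    Fintype.sum_prod_type, Matrix.trace]
  refine Finset.sum_congr rfl fun x _ => ?_
  rw [Matrix.diag, Matrix.mul_apply, Fintype.sum_prod_type, Finset.sum_comm]
  refine Finset.sum_congr rfl fun w _ => ?_
  rw [Matrix.mul_apply, Finset.sum_mul]
  refine Finset.sum_congr rfl fun y _ => ?_
  rw [Fintype.sum_prod_type, Matrix.mul_apply, Matrix.mul_apply, Matrix.mul_apply,
    Finset.sum_mul_sum, Finset.sum_mul]
  refine Finset.sum_congr rfl fun z _ => ?_
  rw [Fintype.sum_prod_type, Finset.sum_mul]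
  refine Finset.sum_congr rfl fun t _ => ?_
  rw [Finset.mul_sum]
  refine Finset.sum_congr rfl fun r _ => ?_
  change _ = Ψ (glue b x z) * star (Ψ (mix _ (glue b y t) (glue b x z))) *
    (Ψ (glue b y t) * star (Ψ (mix _ (glue b w r) (glue b y t)))) *
    (Ψ (glue b w r) * star (Ψ (mix _ (glue b x z) (glue b w r))))
  rw [mix_glue, mix_glue, mix_glue]
  rfl

theorem tensorVec_glue (b : Finset (Fin m)) (u : RegionSpace b κ) (v : RegionSpace bᶜ κ)
    (x : b → κ) (z : ↥bᶜ → κ) : tensorVec b u v (glue b x z) = u x * v z := by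
  simp only [tensorVec, glue_left, glue_right]

theorem tensorVec_mix_glue (b : Finset (Fin m)) (p : Fin m → Prop) (u : RegionSpace b κ)
    (v : RegionSpace bᶜ κ) (x y : b → κ) (z t : ↥bᶜ → κ) :
    tensorVec b u v (mix p (glue b x z) (glue b y t)) =
      u (mix (fun ℓ : b => p ℓ) x y) * v (mix (fun ℓ : ↥bᶜ => p ℓ) z t) := by
  simp only [tensorVec, mix_restrict, glue_left, glue_right]

theorem secondMoment_tensorVec (b : Finset (Fin m)) (p : Fin m → Prop) (u : RegionSpace b κ)
    (v : RegionSpace bᶜ κ) :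
    secondMoment p (tensorVec b u v) =
      secondMoment (fun ℓ : b => p ℓ) u * secondMoment (fun ℓ : ↥bᶜ => p ℓ) v := by
  rw [secondMoment, ← Equiv.sum_comp (glueEquivPair b), Fintype.sum_prod_type, secondMoment,
    secondMoment, Finset.sum_mul_sum]
  refine Finset.sum_congr rfl fun q _ => Finset.sum_congr rfl fun r _ => ?_
  obtain ⟨x, y⟩ := q
  obtain ⟨z, t⟩ := r
  change tensorVec b u v (glue b x z) *
      star (tensorVec b u v (mix _ (glue b y t) (glue b x z))) *
    (tensorVec b u v (glue b y t) * star (tensorVec b u v (mix _ (glue b x z) (glue b y t)))) = _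
  simp only [tensorVec_glue, tensorVec_mix_glue, star_mul']
  ring

theorem thirdMoment_tensorVec (b : Finset (Fin m)) (p : Fin m → Prop) (u : RegionSpace b κ)
    (v : RegionSpace bᶜ κ) :
    thirdMoment p (tensorVec b u v) =
      thirdMoment (fun ℓ : b => p ℓ) u * thirdMoment (fun ℓ : ↥bᶜ => p ℓ) v := by
  rw [thirdMoment, ← Equiv.sum_comp (glueEquivTriple b), Fintype.sum_prod_type, thirdMoment,
    thirdMoment, Finset.sum_mul_sum]
  refine Finset.sum_congr rfl fun q _ => Finset.sum_congr rfl fun r _ => ?_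
  obtain ⟨x, y, w⟩ := q
  obtain ⟨z, t, s⟩ := r
  change tensorVec b u v (glue b x z) *
      star (tensorVec b u v (mix _ (glue b y t) (glue b x z))) *
    (tensorVec b u v (glue b y t) * star (tensorVec b u v (mix _ (glue b w s) (glue b y t)))) *
    (tensorVec b u v (glue b w s) *
      star (tensorVec b u v (mix _ (glue b x z) (glue b w s)))) = _
  simp only [tensorVec_glue, tensorVec_mix_glue, star_mul']
  ring

theorem secondMoment_empty {L : Type*} [Fintype L] [DecidableEq L] (Ψ : (L → κ) → ℂ) :
    secondMoment (fun _ => False) Ψ = (∑ g, Ψ g * star (Ψ g)) ^ 2 := by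
  simp only [secondMoment, mix_false]
  rw [Fintype.sum_prod_type, sq, Finset.sum_mul_sum]

theorem thirdMoment_empty {L : Type*} [Fintype L] [DecidableEq L] (Ψ : (L → κ) → ℂ) :
    thirdMoment (fun _ => False) Ψ = (∑ g, Ψ g * star (Ψ g)) ^ 3 := by
  simp only [thirdMoment, mix_false]
  rw [pow_succ', sq, Finset.sum_mul_sum, Fintype.sum_prod_type, Finset.sum_mul]
  refine Finset.sum_congr rfl fun x _ => ?_
  rw [Fintype.sum_prod_type, Finset.mul_sum]
  refine Finset.sum_congr rfl fun y _ => ?_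
  rw [Finset.mul_sum]
  exact Finset.sum_congr rfl fun z _ => mul_assoc _ _ _

theorem sum_mul_star_eq_one {Ψ : LinkSpace m κ} (hΨ : ‖Ψ‖ = 1) :
    ∑ g, Ψ g * star (Ψ g) = 1 := by
  have h := inner_self_eq_norm_sq_to_K (𝕜 := ℂ) Ψ
  rw [hΨ, PiLp.inner_apply] at h
  simp only [RCLike.inner_apply, RCLike.ofReal_one, one_pow] at h
  exact h

/-- Moments of a product vector are multiplicative. -/
theorem moment_union_of_factorized {b b₁ b₂ : Finset (Fin m)} (h₁ : b₁ ⊆ b) (h₂ : b₂ ⊆ bᶜ)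
    (T : ∀ {L : Type} [Fintype L] [DecidableEq L], (L → Prop) → ((L → κ) → ℂ) → ℂ)
    (hT : ∀ (p : Fin m → Prop) (u : RegionSpace b κ) (v : RegionSpace bᶜ κ),
      T p (tensorVec b u v) = T (fun ℓ : b => p ℓ) u * T (fun ℓ : ↥bᶜ => p ℓ) v)
    (u : RegionSpace b κ) (v : RegionSpace bᶜ κ)
    (hone : T (fun _ => False) (tensorVec b u v) = 1) :
    T (· ∈ b₁ ∪ b₂) (tensorVec b u v) =
      T (· ∈ b₁) (tensorVec b u v) * T (· ∈ b₂) (tensorVec b u v) := by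
  have e₁ : (fun ℓ : b => (ℓ : Fin m) ∈ b₂) = fun _ => False :=
    funext fun ℓ => eq_false fun h => Finset.mem_compl.1 (h₂ h) ℓ.2
  have e₂ : (fun ℓ : ↥bᶜ => (ℓ : Fin m) ∈ b₁) = fun _ => False :=
    funext fun ℓ => eq_false fun h => Finset.mem_compl.1 ℓ.2 (h₁ h)
  have e₃ : (fun ℓ : b => (ℓ : Fin m) ∈ b₁ ∪ b₂) = fun ℓ : b => (ℓ : Fin m) ∈ b₁ :=
    funext fun ℓ => by
      have := congrFun e₁ ℓ
      simp only [eq_iff_iff, iff_false] at this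
      simp [this]
  have e₄ : (fun ℓ : ↥bᶜ => (ℓ : Fin m) ∈ b₁ ∪ b₂) = fun ℓ : ↥bᶜ => (ℓ : Fin m) ∈ b₂ :=
    funext fun ℓ => by
      have := congrFun e₂ ℓ
      simp only [eq_iff_iff, iff_false] at this
      simp [this]
  rw [hT] at hone
  rw [hT, hT, hT, e₁, e₂, e₃, e₄]
  -- The right side exceeds the left by the factor `T(∅) u * T(∅) v`, which is one; `u` and `v` need
  -- not be normalized separately.
  linear_combination (-T (fun ℓ : b => (ℓ : Fin m) ∈ b₁) u *
    T (fun ℓ : ↥bᶜ => (ℓ : Fin m) ∈ b₂) v) * hone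

theorem secondMoment_union {b b₁ b₂ : Finset (Fin m)} (h₁ : b₁ ⊆ b) (h₂ : b₂ ⊆ bᶜ)
    (u : RegionSpace b κ) (v : RegionSpace bᶜ κ) (huv : ‖tensorVec b u v‖ = 1) :
    secondMoment (· ∈ b₁ ∪ b₂) (tensorVec b u v) =
      secondMoment (· ∈ b₁) (tensorVec b u v) * secondMoment (· ∈ b₂) (tensorVec b u v) :=
  moment_union_of_factorized h₁ h₂ secondMoment (secondMoment_tensorVec b) u v
    (by rw [secondMoment_empty, sum_mul_star_eq_one huv, one_pow])

theorem thirdMoment_union {b b₁ b₂ : Finset (Fin m)} (h₁ : b₁ ⊆ b) (h₂ : b₂ ⊆ bᶜ)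
    (u : RegionSpace b κ) (v : RegionSpace bᶜ κ) (huv : ‖tensorVec b u v‖ = 1) :
    thirdMoment (· ∈ b₁ ∪ b₂) (tensorVec b u v) =
      thirdMoment (· ∈ b₁) (tensorVec b u v) * thirdMoment (· ∈ b₂) (tensorVec b u v) :=
  moment_union_of_factorized h₁ h₂ thirdMoment (thirdMoment_tensorVec b) u v
    (by rw [thirdMoment_empty, sum_mul_star_eq_one huv, one_pow])

end MomentLemmas

/-! ### Flat spectra from moments -/

section Flat

open scoped Matrix ComplexOrder

/-- The matrix of a vector of a tensor product. -/
def coeffMatrix {α β : Type*} (χ : EuclideanSpace ℂ (α × β)) : Matrix α β ℂ :=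
  Matrix.of fun i j => χ (i, j)

/-- By flatness `Q = d X X†` is an orthogonal projection fixing `X`, and its trace makes its rank
`d`. Expanding `X = Q X` in an orthonormal basis of the range of `Q` is the Schmidt decomposition.
-/
theorem isMaximallyEntangledOfRank_of_flat {α β : Type*} [Fintype α] [Fintype β]
    (χ : EuclideanSpace ℂ (α × β)) (d : ℕ)
    (hflat : (d : ℂ) • (coeffMatrix χ * (coeffMatrix χ)ᴴ) * coeffMatrix χ = coeffMatrix χ)
    (htr : (coeffMatrix χ * (coeffMatrix χ)ᴴ).trace = 1) :
    IsMaximallyEntangledOfRank χ d := by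
  classical
  set X := coeffMatrix χ with hX
  set Q : Matrix α α ℂ := (d : ℂ) • (X * Xᴴ) with hQ
  have hQQ : Q * Q = Q := by
    conv_lhs => rw [hQ, Matrix.mul_smul, ← Matrix.mul_assoc, hflat]
  have hQH : Qᴴ = Q := by
    simp [hQ, Matrix.conjTranspose_smul, Matrix.conjTranspose_mul]
  let f : Module.End ℂ (EuclideanSpace ℂ α) := Matrix.toEuclideanLin Q
  have hff : f * f = f := by
    apply LinearMap.ext
    intro v
    simp [f, Matrix.toLpLin_apply, hQQ]
  have hproj : LinearMap.IsProj (LinearMap.range f) f :=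
    ⟨fun v => ⟨v, rfl⟩, by
      rintro _ ⟨v, rfl⟩
      exact LinearMap.congr_fun hff v⟩
  have hrank : Module.finrank ℂ (LinearMap.range f) = d := by
    have h1 := hproj.trace
    have h2 : LinearMap.trace ℂ _ f = Q.trace := by
      rw [LinearMap.trace_eq_matrix_trace ℂ (EuclideanSpace.basisFun α ℂ).toBasis]
      congr 1
      ext i j
      simp [f, LinearMap.toMatrix_apply, Matrix.toLpLin_apply]
    rw [h2, hQ, Matrix.trace_smul, htr] at h1
    simpa using h1.symm
  have hd : d ≠ 0 := by
    rintro rfl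
    have : X = 0 := by rw [← hflat]; simp [hQ]
    rw [this] at htr
    simp at htr
  have hd' : ((Real.sqrt d : ℝ) : ℂ) ≠ 0 := by
    simpa using hd
  have hd2 : ((Real.sqrt d : ℝ) : ℂ) * ((Real.sqrt d : ℝ) : ℂ) = d := by
    rw [← Complex.ofReal_mul, Real.mul_self_sqrt (Nat.cast_nonneg d)]
    simp
  let B := (stdOrthonormalBasis ℂ (LinearMap.range f)).reindex (finCongr hrank)
  let e : Fin d → EuclideanSpace ℂ α := fun r => B r
  have he : Orthonormal ℂ e := B.orthonormal.comp_linearIsometry (LinearMap.range f).subtypeₗᵢ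
  have hQe : ∀ r, Q *ᵥ (e r : α → ℂ) = e r := fun r => by
    have := hproj.map_id (e r) (B r).2
    exact congrArg (fun v : EuclideanSpace ℂ α => (v : α → ℂ)) this
  have hsum : ∀ i i', ∑ r, e r i * star (e r i') = Q i i' := by
    intro i i'
    have h := B.sum_repr' ⟨f (EuclideanSpace.single i' 1), ⟨_, rfl⟩⟩
    have h' := congrArg (fun v : LinearMap.range f => (v : EuclideanSpace ℂ α) i) h
    have hfi : ∀ k, f (EuclideanSpace.single i' 1) k = Q k i' := fun k => by
      simp [f, Matrix.toLpLin_apply]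
    rw [hfi] at h'
    rw [← h']
    simp only [Submodule.coe_inner, Submodule.coe_sum, Submodule.coe_smul, WithLp.ofLp_sum,
      Finset.sum_apply, PiLp.smul_apply, smul_eq_mul]
    refine Finset.sum_congr rfl fun r _ => ?_
    rw [mul_comm]
    congr 1
    have h3 : star (e r i') = star ((Q *ᵥ (e r : α → ℂ)) i') := by rw [hQe]
    rw [h3, PiLp.inner_apply]
    simp only [RCLike.inner_apply, hfi, Matrix.mulVec, dotProduct, star_sum, star_mul']
    refine Finset.sum_congr rfl fun k _ => ?_
    rw [← Matrix.conjTranspose_apply, hQH]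
    rfl
  -- The Schmidt partner of `e r` is the partial inner product of `χ` with `e r`; the factor `√d`
  -- normalizes it.
  let f' : Fin d → EuclideanSpace ℂ β := fun r => WithLp.toLp 2 fun j =>
    ((Real.sqrt d : ℝ) : ℂ) * ∑ i, star (e r i) * X i j
  refine ⟨e, f', he, ?_, ?_⟩
  · rw [orthonormal_iff_ite]
    intro r s
    have h1 : inner ℂ (f' r) (f' s) = inner ℂ (e s) (e r) := by
      have h2 : inner ℂ (e s) (e r) = ∑ i, (Q *ᵥ (e r : α → ℂ)) i * star (e s i) := by
        rw [hQe, PiLp.inner_apply]; rfl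
      have hl : inner ℂ (f' r) (f' s) =
          ∑ j, ∑ i, ∑ i', (d : ℂ) * (star (e s i) * X i j * (e r i' * star (X i' j))) := by
        rw [PiLp.inner_apply]
        refine Finset.sum_congr rfl fun j _ => ?_
        have hs : star (f' r j) = ((Real.sqrt d : ℝ) : ℂ) * ∑ i, e r i * star (X i j) := by
          simp [f']
        have : inner ℂ (f' r j) (f' s j) = f' s j * star (f' r j) := rfl
        rw [this, hs]
        simp only [f']
        rw [mul_mul_mul_comm, hd2, Finset.sum_mul_sum, Finset.mul_sum]
        exact Finset.sum_congr rfl fun _ _ => Finset.mul_sum _ _ _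
      have hr : ∑ i, (Q *ᵥ (e r : α → ℂ)) i * star (e s i) =
          ∑ i, ∑ i', ∑ j, (d : ℂ) * (star (e s i) * X i j * (e r i' * star (X i' j))) := by
        refine Finset.sum_congr rfl fun i _ => ?_
        simp only [hQ, Matrix.mulVec, dotProduct, Matrix.smul_apply, Matrix.mul_apply,
          Matrix.conjTranspose_apply, smul_eq_mul, Finset.mul_sum, Finset.sum_mul]
        refine Finset.sum_congr rfl fun _ _ => Finset.sum_congr rfl fun _ _ => ?_
        ring
      rw [h2, hl, hr, Finset.sum_comm]
      exact Finset.sum_congr rfl fun _ _ => Finset.sum_comm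
    rw [h1, orthonormal_iff_ite.1 he s r]
    simp [eq_comm]
  · intro i j
    have h1 : ∑ r, e r i * f' r j = ((Real.sqrt d : ℝ) : ℂ) * (Q * X) i j := by
      simp only [f', Matrix.mul_apply, ← hsum, Finset.mul_sum, Finset.sum_mul]
      rw [Finset.sum_comm]
      refine Finset.sum_congr rfl fun _ _ => Finset.sum_congr rfl fun _ _ => ?_
      ring
    rw [h1, hflat, inv_mul_cancel_left₀ hd']
    rfl

/-- The first three weighted moments all equal `n`, so the weighted variance of the spectrum of `d
ρ` around `1` vanishes. -/
theorem flat_of_moments {ι : Type*} [Fintype ι] {α β : ι → Type*} [∀ i, Fintype (α i)]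
    [∀ i, Fintype (β i)] (d : ι → ℕ) (hd : ∀ i, d i ≠ 0) (X : ∀ i, Matrix (α i) (β i) ℂ)
    (n : ℂ) (hn : n ≠ 0) (h1 : ∑ i, (d i : ℂ) ^ 2 * (X i * (X i)ᴴ).trace = n)
    (h2 : (∑ i, (d i : ℂ) ^ 3 * (X i * (X i)ᴴ * (X i * (X i)ᴴ)).trace) ^ 2 =
      n * ∑ i, (d i : ℂ) ^ 3 * (X i * (X i)ᴴ * (X i * (X i)ᴴ)).trace)
    (h3 : (∑ i, (d i : ℂ) ^ 4 * (X i * (X i)ᴴ * (X i * (X i)ᴴ) * (X i * (X i)ᴴ)).trace) ^ 2 =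
      n * ∑ i, (d i : ℂ) ^ 4 * (X i * (X i)ᴴ * (X i * (X i)ᴴ) * (X i * (X i)ᴴ)).trace) (i : ι) :
    (d i : ℂ) • (X i * (X i)ᴴ) * X i = X i := by
  classical
  set S2 := ∑ i, (d i : ℂ) ^ 3 * (X i * (X i)ᴴ * (X i * (X i)ᴴ)).trace with hS2
  set S3 := ∑ i, (d i : ℂ) ^ 4 * (X i * (X i)ᴴ * (X i * (X i)ᴴ) * (X i * (X i)ᴴ)).trace with hS3
  have hnn : 0 ≤ n := by
    rw [← h1]
    exact Finset.sum_nonneg fun i _ => mul_nonneg (by positivity)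
      (Matrix.posSemidef_self_mul_conjTranspose _).trace_nonneg
  have e2 : S2 = n := by
    have hS2n : S2 ≠ 0 := by
      intro h0
      rw [hS2, Finset.sum_eq_zero_iff_of_nonneg] at h0
      · apply hn
        rw [← h1]
        refine Finset.sum_eq_zero fun i hi => ?_
        have h := (mul_eq_zero.1 (h0 i hi)).resolve_left (by simp [hd i])
        have hH : (X i * (X i)ᴴ)ᴴ = X i * (X i)ᴴ := by simp
        -- With one factor written as an adjoint, the trace is a squared Frobenius norm, so it
        -- vanishes only for the zero matrix.
        nth_rewrite 2 [← hH] at h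
        rw [Matrix.trace_mul_conjTranspose_self_eq_zero_iff] at h
        simp [h]
      · intro i _
        refine mul_nonneg (by positivity) ?_
        have hH : (X i * (X i)ᴴ)ᴴ = X i * (X i)ᴴ := by simp
        nth_rewrite 2 [← hH]
        exact (Matrix.posSemidef_self_mul_conjTranspose _).trace_nonneg
    have : S2 * S2 = n * S2 := by rw [← sq, h2]
    exact mul_right_cancel₀ hS2n this
  -- The defect from flatness; its squared norm `tr(ρ (d ρ - 1)²)` involves only the three moments.
  let Y : ∀ i, Matrix (α i) (β i) ℂ := fun i => (d i : ℂ) • (X i * (X i)ᴴ) * X i - X i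
  have hY : ∀ i, (d i : ℂ) ^ 2 * (Y i * (Y i)ᴴ).trace =
      (d i : ℂ) ^ 4 * (X i * (X i)ᴴ * (X i * (X i)ᴴ) * (X i * (X i)ᴴ)).trace -
      2 * ((d i : ℂ) ^ 3 * (X i * (X i)ᴴ * (X i * (X i)ᴴ)).trace) +
      (d i : ℂ) ^ 2 * (X i * (X i)ᴴ).trace := by
    intro i
    have : Y i * (Y i)ᴴ = (d i : ℂ) ^ 2 • (X i * (X i)ᴴ * (X i * (X i)ᴴ) * (X i * (X i)ᴴ)) -
        (2 * (d i : ℂ)) • (X i * (X i)ᴴ * (X i * (X i)ᴴ)) + X i * (X i)ᴴ := by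
      simp only [Y, Matrix.conjTranspose_sub, Matrix.conjTranspose_mul,
        Matrix.conjTranspose_smul, Matrix.conjTranspose_conjTranspose, Matrix.sub_mul, Matrix.mul_sub,
        Matrix.smul_mul, Matrix.mul_smul, Matrix.mul_assoc, star_natCast]
      module
    rw [this]
    simp only [Matrix.trace_add, Matrix.trace_sub, Matrix.trace_smul, smul_eq_mul]
    ring
  have hYn : ∀ i, 0 ≤ (d i : ℂ) ^ 2 * (Y i * (Y i)ᴴ).trace := fun i =>
    mul_nonneg (by positivity) (Matrix.posSemidef_self_mul_conjTranspose _).trace_nonneg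
  have hsum : ∑ i, (d i : ℂ) ^ 2 * (Y i * (Y i)ᴴ).trace = S3 - n := by
    simp only [hY, Finset.sum_add_distrib, Finset.sum_sub_distrib, ← Finset.mul_sum]
    rw [h1, ← hS2, ← hS3, e2]
    ring
  have e3 : S3 = n := by
    -- Nonnegativity of the defect already bounds `S3` below, which rules out the root `S3 = 0`.
    have hge : n ≤ S3 := by
      rw [← sub_nonneg, ← hsum]
      exact Finset.sum_nonneg fun i _ => hYn i
    have hS3n : S3 ≠ 0 := by
      intro h0
      rw [h0] at hge
      exact hn (le_antisymm hge hnn)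
    have : S3 * S3 = n * S3 := by rw [← sq, h3]
    exact mul_right_cancel₀ hS3n this
  rw [e3, sub_self, Finset.sum_eq_zero_iff_of_nonneg fun i _ => hYn i] at hsum
  have h := (mul_eq_zero.1 (hsum i (Finset.mem_univ i))).resolve_left (by simp [hd i])
  rw [Matrix.trace_mul_conjTranspose_self_eq_zero_iff] at h
  exact sub_eq_zero.1 h

end Flat

/-! ### Reduced states of vectors with edge modes -/

section EdgeModes

open scoped Kronecker Classical

variable {m : ℕ} {κ : Type*} [Fintype κ] {ι : Type*} [Fintype ι]
  {α β : ι → Type*} [∀ i, Fintype (α i)] [∀ i, Fintype (β i)]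
  {k k' : ι → ℕ}

/-- The matrix whose columns are the given vectors. -/
def columns {σ τ : Type*} (w : σ → EuclideanSpace ℂ τ) : Matrix τ σ ℂ :=
  Matrix.of fun x s => w s x

theorem conjTranspose_mul_columns {σ τ : Type*} [DecidableEq σ] [Fintype τ] (w : σ → EuclideanSpace ℂ τ)
    (hw : Orthonormal ℂ w) : (columns w)ᴴ * columns w = 1 := by
  ext s t
  have h := orthonormal_iff_ite.1 hw s t
  rw [PiLp.inner_apply] at h
  rw [Matrix.mul_apply, Matrix.one_apply, ← h]
  refine Finset.sum_congr rfl fun x _ => ?_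
  exact mul_comm _ _

/-- A vector of `⨁ P_μ ⊗ P'_μ ⊗ (auxiliary space)` embedded in `H_b ⊗ H_{bᶜ}`. -/
def edgeVec {b : Finset (Fin m)} (w : (Σ i : ι, Fin (k i) × α i) → RegionSpace b κ)
    (w' : (Σ i : ι, Fin (k' i) × β i) → RegionSpace bᶜ κ)
    (C : ∀ i, Matrix (Fin (k i)) (Fin (k' i)) ℂ) (χ : ∀ i, EuclideanSpace ℂ (α i × β i)) :
    LinkSpace m κ :=
  ∑ i, ∑ a, ∑ a', C i a a' • ∑ s, ∑ t, χ i (s, t) • tensorVec b (w ⟨i, a, s⟩) (w' ⟨i, a', t⟩)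

theorem bipartite_edgeVec {b : Finset (Fin m)}
    (w : (Σ i : ι, Fin (k i) × α i) → RegionSpace b κ)
    (w' : (Σ i : ι, Fin (k' i) × β i) → RegionSpace bᶜ κ)
    (C : ∀ i, Matrix (Fin (k i)) (Fin (k' i)) ℂ) (χ : ∀ i, EuclideanSpace ℂ (α i × β i)) :
    bipartite b (edgeVec w w' C χ) = columns w *
      Matrix.blockDiagonal' (fun i => C i ⊗ₖ coeffMatrix (χ i)) * (columns w')ᵀ := by
  ext x z
  simp only [edgeVec, map_sum, map_smul, bipartite_tensorVec, Matrix.sum_apply,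
    Matrix.smul_apply, Matrix.vecMulVec_apply, smul_eq_mul]
  rw [Matrix.mul_assoc, Matrix.mul_apply, Fintype.sum_sigma]
  refine Finset.sum_congr rfl fun i _ => ?_
  rw [Fintype.sum_prod_type]
  refine Finset.sum_congr rfl fun a _ => ?_
  have h : ∀ s, (Matrix.blockDiagonal' (fun i => C i ⊗ₖ coeffMatrix (χ i)) * (columns w')ᵀ)
      ⟨i, a, s⟩ z = ∑ a', ∑ t, C i a a' * χ i (s, t) * w' ⟨i, a', t⟩ z := by
    intro s
    rw [Matrix.mul_apply, Fintype.sum_sigma, Finset.sum_eq_single i, Fintype.sum_prod_type]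
    · simp [Matrix.blockDiagonal'_apply, columns, coeffMatrix]
    · intro j _ hj
      simp [Matrix.blockDiagonal'_apply, hj.symm]
    · simp
  simp only [h, Finset.mul_sum]
  rw [Finset.sum_comm]
  refine Finset.sum_congr rfl fun s _ => Finset.sum_congr rfl fun a' _ =>
    Finset.sum_congr rfl fun t _ => ?_
  simp only [columns, Matrix.of_apply]
  ring

/-- Tracing out `bᶜ` removes the isometry `U'`. Up to `U`, the reduced state is block diagonal in
`μ`, each block being the state of `P_μ` tensored with that of the edge mode. -/
theorem reduced_edgeVec {b : Finset (Fin m)}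
    {w : (Σ i : ι, Fin (k i) × α i) → RegionSpace b κ}
    {w' : (Σ i : ι, Fin (k' i) × β i) → RegionSpace bᶜ κ} (hw' : Orthonormal ℂ w')
    (C : ∀ i, Matrix (Fin (k i)) (Fin (k' i)) ℂ) (χ : ∀ i, EuclideanSpace ℂ (α i × β i)) :
    bipartite b (edgeVec w w' C χ) * (bipartite b (edgeVec w w' C χ))ᴴ = columns w *
      Matrix.blockDiagonal' (fun i => (C i * (C i)ᴴ) ⊗ₖ
        (coeffMatrix (χ i) * (coeffMatrix (χ i))ᴴ)) * (columns w)ᴴ := by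
  have h1 : (columns w')ᵀ * ((columns w')ᵀ)ᴴ = 1 := by
    have := congrArg Matrix.transpose (conjTranspose_mul_columns w' hw')
    rw [Matrix.transpose_mul, Matrix.transpose_one] at this
    exact this
  have h2 : ∀ i, (C i * (C i)ᴴ) ⊗ₖ (coeffMatrix (χ i) * (coeffMatrix (χ i))ᴴ) =
      (C i ⊗ₖ coeffMatrix (χ i)) * (C i ⊗ₖ coeffMatrix (χ i))ᴴ := by
    intro i
    rw [Matrix.conjTranspose_kronecker, Matrix.mul_kronecker_mul]
  simp only [h2]
  rw [Matrix.blockDiagonal'_mul, ← Matrix.blockDiagonal'_conjTranspose, bipartite_edgeVec,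
    Matrix.conjTranspose_mul, Matrix.conjTranspose_mul]
  set B := Matrix.blockDiagonal' (fun i => C i ⊗ₖ coeffMatrix (χ i))
  calc columns w * B * (columns w')ᵀ * (((columns w')ᵀ)ᴴ * (Bᴴ * (columns w)ᴴ))
      = columns w * B * ((columns w')ᵀ * ((columns w')ᵀ)ᴴ) * Bᴴ * (columns w)ᴴ := by
        simp only [Matrix.mul_assoc]
    _ = _ := by rw [h1, Matrix.mul_one]; simp only [Matrix.mul_assoc]

theorem trace_reduced_edgeVec {b : Finset (Fin m)}
    {w : (Σ i : ι, Fin (k i) × α i) → RegionSpace b κ}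
    {w' : (Σ i : ι, Fin (k' i) × β i) → RegionSpace bᶜ κ} (hw : Orthonormal ℂ w)
    (hw' : Orthonormal ℂ w')
    (C : ∀ i, Matrix (Fin (k i)) (Fin (k' i)) ℂ) (χ : ∀ i, EuclideanSpace ℂ (α i × β i)) :
    (bipartite b (edgeVec w w' C χ) * (bipartite b (edgeVec w w' C χ))ᴴ).trace =
      ∑ i, (C i * (C i)ᴴ).trace * (coeffMatrix (χ i) * (coeffMatrix (χ i))ᴴ).trace := by
  rw [reduced_edgeVec hw', Matrix.trace_mul_comm, ← Matrix.mul_assoc,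
    conjTranspose_mul_columns w hw, Matrix.one_mul, Matrix.trace_blockDiagonal']
  simp only [Matrix.trace_kronecker]

/-- When the state of every `P_μ` is a multiple of the identity, the only unknowns left in the
spectrum come from the `χ_μ`. -/
theorem secondMoment_edgeVec {b : Finset (Fin m)}
    {w : (Σ i : ι, Fin (k i) × α i) → RegionSpace b κ}
    {w' : (Σ i : ι, Fin (k' i) × β i) → RegionSpace bᶜ κ} (hw : Orthonormal ℂ w)
    (hw' : Orthonormal ℂ w') (C : ∀ i, Matrix (Fin (k i)) (Fin (k' i)) ℂ)
    (χ : ∀ i, EuclideanSpace ℂ (α i × β i)) (c : ι → ℂ) (hC : ∀ i, C i * (C i)ᴴ = c i • 1) :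
    secondMoment (· ∈ b) (edgeVec w w' C χ) =
      ∑ i, (k i : ℂ) * c i ^ 2 * (coeffMatrix (χ i) * (coeffMatrix (χ i))ᴴ *
        (coeffMatrix (χ i) * (coeffMatrix (χ i))ᴴ)).trace := by
  rw [← trace_sq_eq_secondMoment, reduced_edgeVec hw']
  have hW := conjTranspose_mul_columns w hw
  set D := Matrix.blockDiagonal' (fun i => (C i * (C i)ᴴ) ⊗ₖ
        (coeffMatrix (χ i) * (coeffMatrix (χ i))ᴴ))
  have h : columns w * D * (columns w)ᴴ * (columns w * D * (columns w)ᴴ) =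
      columns w * (D * D * (columns w)ᴴ) := by
    calc _ = columns w * (D * ((columns w)ᴴ * columns w) * D * (columns w)ᴴ) := by
          simp only [Matrix.mul_assoc]
      _ = _ := by rw [hW, Matrix.mul_one]
  rw [h, Matrix.trace_mul_comm, Matrix.mul_assoc, hW, Matrix.mul_one,
    ← Matrix.blockDiagonal'_mul, Matrix.trace_blockDiagonal']
  refine Finset.sum_congr rfl fun i _ => ?_
  rw [← Matrix.mul_kronecker_mul, Matrix.trace_kronecker, hC]
  congr 1
  simp
  ring

theorem thirdMoment_edgeVec {b : Finset (Fin m)}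
    {w : (Σ i : ι, Fin (k i) × α i) → RegionSpace b κ}
    {w' : (Σ i : ι, Fin (k' i) × β i) → RegionSpace bᶜ κ} (hw : Orthonormal ℂ w)
    (hw' : Orthonormal ℂ w') (C : ∀ i, Matrix (Fin (k i)) (Fin (k' i)) ℂ)
    (χ : ∀ i, EuclideanSpace ℂ (α i × β i)) (c : ι → ℂ) (hC : ∀ i, C i * (C i)ᴴ = c i • 1) :
    thirdMoment (· ∈ b) (edgeVec w w' C χ) =
      ∑ i, (k i : ℂ) * c i ^ 3 * (coeffMatrix (χ i) * (coeffMatrix (χ i))ᴴ *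
        (coeffMatrix (χ i) * (coeffMatrix (χ i))ᴴ) *
        (coeffMatrix (χ i) * (coeffMatrix (χ i))ᴴ)).trace := by
  rw [← trace_cube_eq_thirdMoment, reduced_edgeVec hw']
  have hW := conjTranspose_mul_columns w hw
  set D := Matrix.blockDiagonal' (fun i => (C i * (C i)ᴴ) ⊗ₖ
        (coeffMatrix (χ i) * (coeffMatrix (χ i))ᴴ))
  have h : columns w * D * (columns w)ᴴ * (columns w * D * (columns w)ᴴ) *
      (columns w * D * (columns w)ᴴ) = columns w * (D * D * D * (columns w)ᴴ) := by
    calc _ = columns w * (D * ((columns w)ᴴ * columns w) * D * ((columns w)ᴴ * columns w) * D *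
          (columns w)ᴴ) := by simp only [Matrix.mul_assoc]
      _ = _ := by rw [hW, Matrix.mul_one, Matrix.mul_one]
  rw [h, Matrix.trace_mul_comm, Matrix.mul_assoc, hW, Matrix.mul_one,
    ← Matrix.blockDiagonal'_mul, ← Matrix.blockDiagonal'_mul, Matrix.trace_blockDiagonal']
  refine Finset.sum_congr rfl fun i _ => ?_
  rw [← Matrix.mul_kronecker_mul, ← Matrix.mul_kronecker_mul, Matrix.trace_kronecker, hC]
  congr 1
  simp
  ring

end EdgeModes

/-! ### Isotypic projections and minimal projections of the commutant -/

section GroupMatrices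

variable {G : Type*} [Group G] [Fintype G] {ι : Type*} [Fintype ι] [DecidableEq ι]

/-- The isotypic operator `(d_μ / |G|) ∑_h χ_μ(h) s(h)` of a matrix representation `s`. -/
def isotypic (s : G →* Matrix ι ι ℂ) (μ : Irrep G) : Matrix ι ι ℂ :=
  ((μ.dim : ℂ) / (Fintype.card G : ℂ)) • ∑ h, μ.character h • s h

open scoped Classical in
theorem isotypic_mul_isotypic (s : G →* Matrix ι ι ℂ) (μ ν : Irrep G) :
    isotypic s μ * isotypic s ν = if μ = ν then isotypic s μ else 0 := by
  have h1 : (∑ h, μ.character h • s h) * ∑ k, ν.character k • s k =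
      ∑ g, (∑ h, μ.character h * ν.character (h⁻¹ * g)) • s g := by
    simp only [Finset.sum_smul]
    rw [Finset.sum_mul, Finset.sum_comm]
    refine Finset.sum_congr rfl fun h _ => ?_
    rw [Finset.mul_sum]
    refine Fintype.sum_equiv (Equiv.mulLeft h) _ _ fun k => ?_
    simp [smul_smul, mul_comm]
  have hd := μ.dim_ne_zero
  have hn := Irrep.card_ne_zero (G := G)
  have h2 : ∀ g, ∑ h, μ.character h * ν.character (h⁻¹ * g) =
      (if μ = ν then (Fintype.card G : ℂ) * μ.character g else 0) / μ.dim := fun g => by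
    rw [eq_div_iff hd, mul_comm, Irrep.sum_character_mul_character]
  simp only [isotypic, smul_mul_assoc, mul_smul_comm, h1, h2]
  split_ifs with h
  · subst h
    rw [Finset.smul_sum, Finset.smul_sum, Finset.smul_sum]
    refine Finset.sum_congr rfl fun g _ => ?_
    rw [smul_smul, smul_smul, smul_smul]
    congr 1
    field_simp
  · simp

theorem isotypic_conjTranspose (s : G →* Matrix ι ι ℂ) (hs : ∀ h, (s h)ᴴ = s h⁻¹)
    (μ : Irrep G) : (isotypic s μ)ᴴ = isotypic s μ := by
  simp only [isotypic, Matrix.conjTranspose_smul, Matrix.conjTranspose_sum, hs, star_div₀,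
    star_natCast, ← Irrep.character_inv]
  congr 1
  exact Equiv.sum_comp (Equiv.inv G) fun h => μ.character h • s h

/-- The average of `W` over the conjugates by a matrix representation. -/
def twirl (s : G →* Matrix ι ι ℂ) (W : Matrix ι ι ℂ) : Matrix ι ι ℂ :=
  (Fintype.card G : ℂ)⁻¹ • ∑ k, s k * W * s k⁻¹

theorem twirl_commute (s : G →* Matrix ι ι ℂ) (W : Matrix ι ι ℂ) (h : G) :
    twirl s W * s h = s h * twirl s W := by
  simp only [twirl, smul_mul_assoc, mul_smul_comm, Finset.mul_sum, Finset.sum_mul]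
  congr 1
  refine Fintype.sum_equiv (Equiv.mulLeft h⁻¹) _ _ fun k => ?_
  simp only [Equiv.coe_mulLeft, ← mul_assoc, ← map_mul]
  simp [mul_assoc]

/-- A conjugation average acts as a scalar on each isotypic part. The inverse appears because
`isotypic` weights `s h` by `χ_μ(h)` without conjugation, so it selects the dual of `μ`. -/
theorem twirl_mul_isotypic (s : G →* Matrix ι ι ℂ) (μ : Irrep G) (g : G) :
    twirl s (s g) * isotypic s μ = (μ.character g⁻¹ / μ.dim) • isotypic s μ := by
  have hd := μ.dim_ne_zero
  have hn := Irrep.card_ne_zero (G := G)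
  have h1 : (∑ k, s k * s g * s k⁻¹) * ∑ h, μ.character h • s h =
      ∑ l, (∑ k, μ.character (k * g⁻¹ * k⁻¹ * l)) • s l := by
    simp only [Finset.sum_smul]
    rw [Finset.sum_mul, Finset.sum_comm]
    refine Finset.sum_congr rfl fun k _ => ?_
    rw [Finset.mul_sum]
    refine Fintype.sum_equiv (Equiv.mulLeft (k * g * k⁻¹)) _ _ fun h => ?_
    simp only [Equiv.coe_mulLeft, mul_smul_comm, ← map_mul]
    congr 2
    group
  have h2 : ∀ l, ∑ k, μ.character (k * g⁻¹ * k⁻¹ * l) =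
      (Fintype.card G : ℂ) * (μ.character g⁻¹ * μ.character l) / μ.dim := fun l => by
    rw [eq_div_iff hd, mul_comm, Irrep.sum_character_conj_mul]
  simp only [twirl, isotypic, smul_mul_assoc, mul_smul_comm, h1, h2]
  simp only [Finset.smul_sum, smul_smul]
  refine Finset.sum_congr rfl fun l _ => ?_
  congr 1
  field_simp

/-- A minimal projection of the commutant in the `μ`-isotypic part has rank `d_μ`. -/
theorem trace_minimal (s : G →* Matrix ι ι ℂ) (μ : Irrep G) (Y : Matrix ι ι ℂ)
    (hcomm : ∀ h, Y * s h = s h * Y) (hYY : Y * Y = Y) (hF : isotypic s μ * Y = Y)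
    (hmin : ∀ Z, (∀ h, Z * s h = s h * Z) → ∃ c : ℂ, Y * Z * Y = c • Y) (hne : Y.trace ≠ 0) :
    Y.trace ^ 2 = (μ.dim : ℂ) ^ 2 := by
  have hd := μ.dim_ne_zero
  have hn := Irrep.card_ne_zero (G := G)
  -- Schur's lemma on the range of `Y`: minimality makes the compressed average a multiple of `Y`,
  -- and comparing traces finds the multiple.
  have hA : ∀ W, Y.trace • (Y * twirl s W * Y) = (Y * W).trace • Y := by
    intro W
    obtain ⟨c, hc⟩ := hmin _ (twirl_commute s W)
    have h1 : (Y * twirl s W * Y).trace = (Y * W).trace := by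
      rw [Matrix.trace_mul_comm, ← Matrix.mul_assoc, hYY, twirl, Matrix.mul_smul,
        Matrix.trace_smul, Matrix.mul_sum, Matrix.trace_sum]
      have : ∀ k, (Y * (s k * W * s k⁻¹)).trace = (Y * W).trace := fun k => by
        rw [← Matrix.mul_assoc, Matrix.trace_mul_comm, ← Matrix.mul_assoc, ← Matrix.mul_assoc,
          ← hcomm, Matrix.mul_assoc Y, ← map_mul]
        simp
      simp only [this]
      simp
    rw [hc, Matrix.trace_smul] at h1
    rw [hc, ← h1, smul_smul, smul_eq_mul, mul_comm]
  -- The character `tr(Y s(k))` of the representation on the range of `Y` has norm one. This follows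
  -- by taking matrix units for `W` in `hA` and summing over them.
  have hnorm : ∑ k, (Y * s k).trace * (Y * s k⁻¹).trace = Fintype.card G := by
    have hentry : ∀ u v, Y.trace * ((Fintype.card G : ℂ)⁻¹ *
        ∑ k, (Y * s k) v v * (s k⁻¹ * Y) u u) = Y u v * Y v u := by
      intro u v
      have h := congrFun (congrFun (hA (Matrix.single v u 1)) v) u
      have h2 : (Y * Matrix.single v u 1).trace = Y u v := by
        rw [Matrix.trace_mul_comm, Matrix.trace_single_mul]; simp
      rw [h2, Matrix.smul_apply, Matrix.smul_apply, smul_eq_mul, smul_eq_mul] at h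
      rw [← h]
      congr 1
      simp only [twirl, Matrix.mul_smul, Matrix.smul_mul, Matrix.mul_sum, Matrix.sum_mul,
        Matrix.smul_apply, Matrix.sum_apply, smul_eq_mul]
      congr 1
      refine Finset.sum_congr rfl fun k _ => ?_
      have : Y * (s k * Matrix.single v u 1 * s k⁻¹) * Y =
          (Y * s k) * Matrix.single v u 1 * (s k⁻¹ * Y) := by simp only [Matrix.mul_assoc]
      have hg : ∀ A B : Matrix ι ι ℂ, (A * Matrix.single v u (1 : ℂ) * B) v u =
          A v v * B u u := by
        intro A B
        rw [Matrix.mul_apply, Finset.sum_eq_single u]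
        · rw [Matrix.mul_single_apply_same, mul_one]
        · intro j _ hj
          rw [Matrix.mul_single_apply_of_ne _ _ _ _ _ hj, zero_mul]
        · simp
      rw [this, hg]
    have hs : Y.trace * ((Fintype.card G : ℂ)⁻¹ * ∑ k, (Y * s k).trace * (Y * s k⁻¹).trace) =
        Y.trace := by
      calc _ = ∑ u, ∑ v, Y.trace * ((Fintype.card G : ℂ)⁻¹ *
                ∑ k, (Y * s k) v v * (s k⁻¹ * Y) u u) := by
              simp only [← Finset.mul_sum]
              congr 2
              have hk : ∀ k, (Y * s k).trace * (Y * s k⁻¹).trace =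
                  ∑ u, ∑ v, (Y * s k) v v * (s k⁻¹ * Y) u u := fun k => by
                rw [hcomm k⁻¹, Matrix.trace, Matrix.trace, Finset.sum_mul_sum, Finset.sum_comm]
                rfl
              simp only [hk]
              rw [Finset.sum_comm]
              exact Finset.sum_congr rfl fun _ _ => Finset.sum_comm
        _ = ∑ u, ∑ v, Y u v * Y v u := by simp only [hentry]
        _ = (Y * Y).trace := by simp [Matrix.trace, Matrix.mul_apply]
        _ = _ := by rw [hYY]
    have := mul_left_cancel₀ hne (hs.trans (mul_one _).symm)
    rwa [inv_mul_eq_iff_eq_mul₀ hn, mul_one] at this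
  -- Lying in the isotypic part makes that character proportional to the dual of `χ_μ`; equality of
  -- norms then gives `(tr Y / d_μ)² = 1`.
  have hτ : ∀ g, (Y * s g).trace = Y.trace * μ.character g⁻¹ / μ.dim := by
    intro g
    have h1 : Y * twirl s (s g) * Y = (μ.character g⁻¹ / μ.dim) • Y := by
      have h2 : Y * twirl s (s g) = twirl s (s g) * Y := by
        simp only [twirl, Matrix.mul_smul, Matrix.smul_mul, Matrix.mul_sum, Matrix.sum_mul]
        congr 1
        refine Finset.sum_congr rfl fun k _ => ?_
        rw [← map_mul, ← map_mul, hcomm]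
      rw [h2, Matrix.mul_assoc, hYY]
      conv_lhs => rw [← hF]
      rw [← Matrix.mul_assoc, twirl_mul_isotypic, Matrix.smul_mul, hF]
    have h2 := hA (s g)
    rw [h1, smul_smul] at h2
    have h3 := congrArg Matrix.trace h2
    rw [Matrix.trace_smul, Matrix.trace_smul, smul_eq_mul, smul_eq_mul] at h3
    rw [← mul_right_cancel₀ hne h3]
    ring
  have h := Irrep.sum_character_mul_inv μ μ
  rw [if_pos rfl] at h
  have h2 : ∑ k, (Y * s k).trace * (Y * s k⁻¹).trace =
      (Y.trace / μ.dim) ^ 2 * ∑ k, μ.character k * μ.character k⁻¹ := by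
    rw [Finset.mul_sum]
    refine Finset.sum_congr rfl fun k _ => ?_
    rw [hτ, hτ, inv_inv]
    field_simp
  rw [hnorm, h] at h2
  field_simp at h2
  exact h2.symm

end GroupMatrices

/-! ### Left translations on a region -/

section ShiftMatrix

variable {G : Type*} [Group G] [Fintype G] [DecidableEq G] {L : Type*} [Fintype L]
  [DecidableEq L]

variable (L) in
/-- The matrix of simultaneous left translation by `h` on `L²(G)^{⊗ L}`. -/
def shiftMatrix : G →* Matrix (L → G) (L → G) ℂ where
  toFun h := Matrix.of fun x y => if y = fun ℓ => h⁻¹ * x ℓ then 1 else 0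
  map_one' := by
    ext x y
    simp [Matrix.one_apply, eq_comm]
  map_mul' h k := by
    ext x y
    rw [Matrix.mul_apply, Finset.sum_eq_single fun ℓ => h⁻¹ * x ℓ]
    · simp [mul_assoc]
    · intro z _ hz
      simp [hz]
    · simp

theorem shiftMatrix_apply (h : G) (x y : L → G) :
    shiftMatrix L h x y = if y = fun ℓ => h⁻¹ * x ℓ then 1 else 0 := rfl

theorem shiftMatrix_mul_apply {σ : Type*} (h : G) (M : Matrix (L → G) σ ℂ) (x : L → G) (z : σ) :
    (shiftMatrix L h * M) x z = M (fun ℓ => h⁻¹ * x ℓ) z := by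
  simp [Matrix.mul_apply, shiftMatrix_apply]

theorem mul_shiftMatrix_transpose_apply {σ : Type*} (h : G) (M : Matrix σ (L → G) ℂ) (x : σ)
    (z : L → G) : (M * (shiftMatrix L h)ᵀ) x z = M x (fun ℓ => h⁻¹ * z ℓ) := by
  simp [Matrix.mul_apply, shiftMatrix_apply]

theorem shiftMatrix_conjTranspose (h : G) : (shiftMatrix L h)ᴴ = shiftMatrix L h⁻¹ := by
  ext x y
  simp only [Matrix.conjTranspose_apply, shiftMatrix_apply, inv_inv]
  have : (x = fun ℓ => h⁻¹ * y ℓ) ↔ (y = fun ℓ => h * x ℓ) := by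
    constructor <;> rintro rfl <;> funext ℓ <;> simp
  simp only [this]
  split_ifs <;> simp

theorem trace_shiftMatrix [Nonempty L] (h : G) (hh : h ≠ 1) : (shiftMatrix L h).trace = 0 := by
  refine Finset.sum_eq_zero fun x _ => ?_
  rw [Matrix.diag, shiftMatrix_apply, if_neg]
  intro hx
  obtain ⟨ℓ⟩ := ‹Nonempty L›
  have := congrFun hx ℓ
  exact hh (by simpa using this)

end ShiftMatrix

/-! ### Physical states, region operators and maximally mixed regions -/

section Physical

variable {G : Type*} [Group G] [Fintype G] {m : ℕ}

/-- The inner product of `H_m`, given explicitly because `ℂ` also acts as a C⋆-algebra. -/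
instance physicalInner : Inner ℂ (physical G m) := InnerProductSpace.toInner

theorem physical_inner_smul_right (c : ℂ) (φ ψ : physical G m) :
    inner ℂ φ (c • ψ) = c * inner ℂ φ ψ :=
  inner_smul_right (𝕜 := ℂ) (E := LinkSpace m G) _ _ _

theorem physical_inner_smul_left (c : ℂ) (φ ψ : physical G m) :
    inner ℂ (c • φ) ψ = star c * inner ℂ φ ψ :=
  inner_smul_left (𝕜 := ℂ) (E := LinkSpace m G) _ _ _

theorem shift_mul_shift (b : Finset (Fin m)) (h k : G) :
    shift b h * shift b k = shift b (h * k) := by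
  ext ψ g
  simp only [shift, Module.End.mul_apply, LinearMap.coe_mk, AddHom.coe_mk]
  refine congrArg ψ (funext fun ℓ => ?_)
  split_ifs <;> simp [mul_assoc]

theorem shift_univ_eq_of_mem_physical {ψ : LinkSpace m G} (hψ : ψ ∈ physical G m) (h : G) :
    shift Finset.univ h ψ = ψ := by
  obtain ⟨φ, rfl⟩ := hψ
  rw [← Module.End.mul_apply]
  congr 1
  rw [gaussProj, mul_smul_comm, Finset.mul_sum]
  simp only [shift_mul_shift]
  congr 1
  exact Equiv.sum_comp (Equiv.mulLeft h) fun k => shift (m := m) Finset.univ k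

theorem mem_physical_of_shift_univ_eq {ψ : LinkSpace m G}
    (hψ : ∀ h : G, shift Finset.univ h ψ = ψ) : ψ ∈ physical G m := by
  refine ⟨ψ, ?_⟩
  simp [gaussProj, hψ, ← Nat.cast_smul_eq_nsmul ℂ]

variable [DecidableEq G]

theorem bipartite_shift (b : Finset (Fin m)) (h : G) (ψ : LinkSpace m G) :
    bipartite b (shift b h ψ) = shiftMatrix b h * bipartite b ψ := by
  ext x z
  rw [shiftMatrix_mul_apply]
  simp only [bipartite_apply, shift, LinearMap.coe_mk, AddHom.coe_mk]
  refine congrArg ψ (funext fun ℓ => ?_)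
  simp only [glue]
  split_ifs <;> rfl

theorem bipartite_shift_univ (b : Finset (Fin m)) (h : G) (ψ : LinkSpace m G) :
    bipartite b (shift Finset.univ h ψ) =
      shiftMatrix b h * bipartite b ψ * (shiftMatrix ↥bᶜ h)ᵀ := by
  ext x z
  rw [mul_shiftMatrix_transpose_apply, shiftMatrix_mul_apply]
  simp only [bipartite_apply, shift, LinearMap.coe_mk, AddHom.coe_mk]
  refine congrArg ψ (funext fun ℓ => ?_)
  simp only [glue, Finset.mem_univ, if_true]
  split_ifs <;> rfl

theorem bipartite_gaussProj (b : Finset (Fin m)) (ψ : LinkSpace m G) :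
    bipartite b (gaussProj G m ψ) = (Fintype.card G : ℂ)⁻¹ •
      ∑ h : G, shiftMatrix b h * bipartite b ψ * (shiftMatrix ↥bᶜ h)ᵀ := by
  simp [gaussProj, bipartite_shift_univ]

theorem bipartite_fluxPre (b : Finset (Fin m)) (μ : Irrep G) (ψ : LinkSpace m G) :
    bipartite b (fluxPre b μ ψ) = isotypic (shiftMatrix b) μ * bipartite b ψ := by
  simp [fluxPre, isotypic, bipartite_shift, Matrix.sum_mul]

/-- The matrix of a physical state with respect to the bipartition `b | bᶜ`. -/
def physMatrix (b : Finset (Fin m)) (ψ : physical G m) : Matrix (b → G) (↥bᶜ → G) ℂ :=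
  bipartite b (ψ : LinkSpace m G)

omit [DecidableEq G] in
theorem physMatrix_injective (b : Finset (Fin m)) :
    Function.Injective (physMatrix (G := G) b) :=
  (bipartite_injective b).comp Subtype.val_injective

omit [DecidableEq G] in
theorem inner_eq_trace_physMatrix (b : Finset (Fin m)) (φ ψ : physical G m) :
    inner ℂ φ ψ = (physMatrix b ψ * (physMatrix b φ)ᴴ).trace := by
  rw [Submodule.coe_inner, inner_eq_trace b]; rfl

theorem physMatrix_flux (b : Finset (Fin m)) (μ : Irrep G) (ψ : physical G m) :
    physMatrix b (flux b μ ψ) = isotypic (shiftMatrix b) μ * physMatrix b ψ :=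
  bipartite_fluxPre b μ ψ

/-- Gauss's law: translating `b` by `h` has the same effect as translating `bᶜ` by `h⁻¹`. -/
theorem shiftMatrix_mul_physMatrix (b : Finset (Fin m)) (h : G) (ψ : physical G m) :
    shiftMatrix b h * physMatrix b ψ = physMatrix b ψ * (shiftMatrix ↥bᶜ h⁻¹)ᵀ := by
  have h1 := bipartite_shift_univ b h (ψ : LinkSpace m G)
  rw [shift_univ_eq_of_mem_physical ψ.2] at h1
  conv_rhs => rw [physMatrix, h1]
  rw [Matrix.mul_assoc, ← Matrix.transpose_mul, ← map_mul]
  simp [physMatrix]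

theorem inner_flux_left (b : Finset (Fin m)) (μ : Irrep G) (φ ψ : physical G m) :
    inner ℂ (flux b μ φ) ψ = inner ℂ φ (flux b μ ψ) := by
  rw [inner_eq_trace_physMatrix b, inner_eq_trace_physMatrix b, physMatrix_flux, physMatrix_flux,
    Matrix.conjTranspose_mul, isotypic_conjTranspose _ shiftMatrix_conjTranspose,
    ← Matrix.mul_assoc, Matrix.trace_mul_comm, Matrix.mul_assoc]

open scoped Classical in
theorem flux_flux (b : Finset (Fin m)) (μ ν : Irrep G) (ψ : physical G m) :
    flux b μ (flux b ν ψ) = if μ = ν then flux b μ ψ else 0 := by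
  apply physMatrix_injective b
  rw [physMatrix_flux, physMatrix_flux, ← Matrix.mul_assoc, isotypic_mul_isotypic]
  split_ifs with h
  · rw [physMatrix_flux]
  · simp [physMatrix]

/-- `X` acts on the physical states as the matrix `A` on the region `b`. -/
def ActsAs (b : Finset (Fin m)) (X : Module.End ℂ (physical G m))
    (A : Matrix (b → G) (b → G) ℂ) : Prop :=
  ∀ ψ, physMatrix b (X ψ) = A * physMatrix b ψ

theorem exists_actsAs {b : Finset (Fin m)} {X : Module.End ℂ (physical G m)}
    (hX : X ∈ regionAlgebra b) : ∃ A, ActsAs b X A := by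
  obtain ⟨Y, -, hY⟩ := hX
  obtain ⟨A, rfl⟩ := (Matrix.toEuclideanLin (𝕜 := ℂ) (m := b → G) (n := b → G)).surjective Y
  exact ⟨A, fun ψ => by rw [physMatrix, hY, bipartite_localOp]; rfl⟩

theorem exists_actsAs_compl {b : Finset (Fin m)} {X : Module.End ℂ (physical G m)}
    (hX : X ∈ regionAlgebra bᶜ) : ∃ A : Matrix (↥bᶜ → G) (↥bᶜ → G) ℂ,
      ∀ ψ, physMatrix b (X ψ) = physMatrix b ψ * Aᵀ := by
  obtain ⟨Y, -, hY⟩ := hX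
  obtain ⟨A, rfl⟩ := (Matrix.toEuclideanLin (𝕜 := ℂ) (m := ↥bᶜ → G) (n := ↥bᶜ → G)).surjective Y
  exact ⟨A, fun ψ => by rw [physMatrix, hY, bipartite_localOp_compl]; rfl⟩

/-- Lets minimality of a projection in `A_b` be transferred to the whole commutant of the
translations on `b`. -/
theorem exists_mem_regionAlgebra (b : Finset (Fin m)) (Z : Matrix (b → G) (b → G) ℂ)
    (hZ : ∀ h, Z * shiftMatrix b h = shiftMatrix b h * Z) :
    ∃ X ∈ regionAlgebra (G := G) b, ActsAs b X Z := by
  have hc : Commute (localOp b (Matrix.toEuclideanLin Z)) (gaussProj G m) := by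
    apply LinearMap.ext
    intro φ
    apply bipartite_injective b
    rw [Module.End.mul_apply, Module.End.mul_apply, bipartite_localOp, bipartite_gaussProj,
      bipartite_gaussProj, bipartite_localOp, Matrix.mul_smul, Matrix.mul_sum]
    congr 1
    refine Finset.sum_congr rfl fun h _ => ?_
    rw [← Matrix.mul_assoc, ← Matrix.mul_assoc, ← Matrix.mul_assoc, hZ]
  let X : Module.End ℂ (physical G m) := (localOp b (Matrix.toEuclideanLin Z)).restrict (by
    rintro _ ⟨φ, rfl⟩
    exact ⟨_, (LinearMap.congr_fun hc φ).symm⟩)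
  exact ⟨X, ⟨_, hc, fun ψ => rfl⟩, fun ψ => bipartite_localOp b Z ψ⟩

namespace ActsAs

variable {b : Finset (Fin m)} {X X' : Module.End ℂ (physical G m)}
  {A A' : Matrix (b → G) (b → G) ℂ}

omit [DecidableEq G] in
theorem mul (h : ActsAs b X A) (h' : ActsAs b X' A') : ActsAs b (X * X') (A * A') := fun ψ => by
  rw [Module.End.mul_apply, h, h', Matrix.mul_assoc]

end ActsAs

/-- The reduced state of `ψ` on the region `b` is maximally mixed. -/
def IsMaximallyMixed (b : Finset (Fin m)) (ψ : physical G m) : Prop :=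
  physMatrix b ψ * (physMatrix b ψ)ᴴ = (Fintype.card (b → G) : ℂ)⁻¹ • 1

namespace IsMaximallyMixed

variable {b : Finset (Fin m)} {ψ : physical G m}

/-- The reduced state is invertible, so `ψ` is separating for the operators on `b`: relations among
region operators become relations among their matrices. -/
theorem cancel (hψ : IsMaximallyMixed b ψ) {A B : Matrix (b → G) (b → G) ℂ}
    (h : A * physMatrix b ψ = B * physMatrix b ψ) : A = B := by
  have h1 := congrArg (· * (physMatrix b ψ)ᴴ) h
  simp only [Matrix.mul_assoc] at h1
  rw [hψ, Matrix.mul_smul, Matrix.mul_smul, Matrix.mul_one, Matrix.mul_one] at h1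
  exact smul_right_injective _ (by simp) h1

theorem actsAs_ext (hψ : IsMaximallyMixed b ψ) {X X' : Module.End ℂ (physical G m)}
    {A A' : Matrix (b → G) (b → G) ℂ} (h : ActsAs b X A) (h' : ActsAs b X' A')
    (e : X ψ = X' ψ) : A = A' :=
  hψ.cancel (by rw [← h, ← h', e])

/-- A translation of `b` can be moved to `bᶜ` by Gauss's law, past any operator on `b`. -/
theorem commute (hψ : IsMaximallyMixed b ψ) {X : Module.End ℂ (physical G m)}
    {A : Matrix (b → G) (b → G) ℂ} (hX : ActsAs b X A) (h : G) :
    A * shiftMatrix b h = shiftMatrix b h * A := by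
  apply hψ.cancel
  rw [Matrix.mul_assoc, Matrix.mul_assoc, shiftMatrix_mul_physMatrix, ← hX,
    shiftMatrix_mul_physMatrix, hX, Matrix.mul_assoc]

theorem inner_eq (hψ : IsMaximallyMixed b ψ) {X : Module.End ℂ (physical G m)}
    {A : Matrix (b → G) (b → G) ℂ} (hX : ActsAs b X A) :
    inner ℂ ψ (X ψ) = (Fintype.card (b → G) : ℂ)⁻¹ * A.trace := by
  rw [inner_eq_trace_physMatrix b, hX, Matrix.mul_assoc, hψ, Matrix.mul_smul, Matrix.mul_one,
    Matrix.trace_smul, smul_eq_mul]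

/-- A translation by `h ≠ 1` moves every configuration of a nonempty region, so only `h = 1`
contributes to the trace of the flux projector. -/
theorem inner_flux (hψ : IsMaximallyMixed b ψ) (hb : b.Nonempty) (μ : Irrep G) :
    inner ℂ ψ (flux b μ ψ) = (μ.dim : ℂ) ^ 2 / Fintype.card G := by
  have : Nonempty b := hb.to_subtype
  rw [hψ.inner_eq (physMatrix_flux b μ), isotypic, Matrix.trace_smul, Matrix.trace_sum,
    Finset.sum_eq_single 1]
  · have hN : (Fintype.card (b → G) : ℂ) ≠ 0 := by simp
    rw [map_one, Matrix.trace_smul, Matrix.trace_one, Irrep.character_one, smul_eq_mul,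
      smul_eq_mul]
    field_simp
  · intro h _ hh
    rw [Matrix.trace_smul, trace_shiftMatrix h hh, smul_zero]
  · simp

end IsMaximallyMixed

end Physical

/-! ### States and matrix units in the sector decomposition -/

theorem Orthonormal.eq_sum_of_mem_span {E ι : Type*} [NormedAddCommGroup E]
    [InnerProductSpace ℂ E] [Fintype ι] {e : ι → E} (he : Orthonormal ℂ e) {v : E}
    (hv : v ∈ Submodule.span ℂ (Set.range e)) : v = ∑ i, inner ℂ (e i) v • e i := by
  obtain ⟨c, rfl⟩ := (Submodule.mem_span_range_iff_exists_fun ℂ).1 hv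
  refine Finset.sum_congr rfl fun i _ => ?_
  rw [he.inner_right_fintype]

namespace SectorSplitting

variable {G : Type*} [Group G] [Fintype G] {m : ℕ} {b : Finset (Fin m)}
  (S : SectorSplitting G b)

/-- The coefficients of the component of `ψ` in the sector `μ`. -/
def coeff (ψ : physical G m) (μ : Irrep G) : Matrix (Fin (S.k μ)) (Fin (S.k' μ)) ℂ :=
  Matrix.of fun a a' => inner ℂ (S.e μ (a, a')) ψ

theorem flux_e (μ : Irrep G) (p : Fin (S.k μ) × Fin (S.k' μ)) :
    flux b μ (S.e μ p) = S.e μ p := by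
  classical
  have h : S.e μ p ∈ LinearMap.range (flux b μ) := by
    rw [← S.span_eq]
    exact Submodule.subset_span ⟨p, rfl⟩
  obtain ⟨φ, hφ⟩ := h
  rw [← hφ, flux_flux, if_pos rfl]

theorem inner_e_flux (μ : Irrep G) (p : Fin (S.k μ) × Fin (S.k' μ)) (ψ : physical G m) :
    inner ℂ (S.e μ p) (flux b μ ψ) = inner ℂ (S.e μ p) ψ := by
  classical
  rw [← inner_flux_left, flux_e]

theorem inner_e_of_ne {μ ν : Irrep G} (h : μ ≠ ν) (p : Fin (S.k μ) × Fin (S.k' μ))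
    (q : Fin (S.k ν) × Fin (S.k' ν)) : inner ℂ (S.e μ p) (S.e ν q) = 0 := by
  classical
  rw [← S.flux_e ν q, ← S.inner_e_flux, flux_flux, if_neg h, inner_zero_right]

theorem flux_eq_sum (μ : Irrep G) (ψ : physical G m) :
    flux b μ ψ = ∑ a, ∑ a', S.coeff ψ μ a a' • S.e μ (a, a') := by
  have h : flux b μ ψ ∈ Submodule.span ℂ (Set.range (S.e μ)) := by
    rw [S.span_eq]; exact ⟨ψ, rfl⟩
  rw [(S.orthonormal μ).eq_sum_of_mem_span h, Fintype.sum_prod_type]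
  simp only [inner_e_flux]
  rfl

/-- The operator `|a⟩⟨c| ⊗ 1` of the sector `μ`. -/
def matrixUnit (μ : Irrep G) (a c : Fin (S.k μ)) : Module.End ℂ (physical G m) :=
  ∑ a', (innerₛₗ ℂ (S.e μ (c, a'))).smulRight (S.e μ (a, a'))

/-- The operator `1 ⊗ |a'⟩⟨c'|` of the sector `μ`. -/
def matrixUnit' (μ : Irrep G) (a' c' : Fin (S.k' μ)) : Module.End ℂ (physical G m) :=
  ∑ a, (innerₛₗ ℂ (S.e μ (a, c'))).smulRight (S.e μ (a, a'))

theorem matrixUnit_apply (μ : Irrep G) (a c : Fin (S.k μ)) (ψ : physical G m) :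
    S.matrixUnit μ a c ψ = ∑ a', S.coeff ψ μ c a' • S.e μ (a, a') := by
  simp [matrixUnit, coeff]

theorem matrixUnit'_apply (μ : Irrep G) (a' c' : Fin (S.k' μ)) (ψ : physical G m) :
    S.matrixUnit' μ a' c' ψ = ∑ a, S.coeff ψ μ a c' • S.e μ (a, a') := by
  simp [matrixUnit', coeff]

theorem coeff_e (μ : Irrep G) (a c : Fin (S.k μ)) (a' c' : Fin (S.k' μ)) :
    S.coeff (S.e μ (a, a')) μ c c' = if c = a ∧ c' = a' then 1 else 0 := by
  simp [coeff, orthonormal_iff_ite.1 (S.orthonormal μ)]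

theorem coeff_e_of_ne {μ ν : Irrep G} (h : μ ≠ ν) (p : Fin (S.k ν) × Fin (S.k' ν)) :
    S.coeff (S.e ν p) μ = 0 := by
  ext a a'
  exact S.inner_e_of_ne h _ _

theorem matrixUnit_e (μ : Irrep G) (a c x : Fin (S.k μ)) (x' : Fin (S.k' μ)) :
    S.matrixUnit μ a c (S.e μ (x, x')) = if c = x then S.e μ (a, x') else 0 := by
  rw [matrixUnit_apply]
  simp only [coeff_e]
  split_ifs with h <;> simp [h]

theorem matrixUnit'_e (μ : Irrep G) (a' c' x' : Fin (S.k' μ)) (x : Fin (S.k μ)) :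
    S.matrixUnit' μ a' c' (S.e μ (x, x')) = if c' = x' then S.e μ (x, a') else 0 := by
  rw [matrixUnit'_apply]
  simp only [coeff_e]
  split_ifs with h <;> simp [h]

theorem matrixUnit_mem (μ : Irrep G) (a c : Fin (S.k μ)) :
    S.matrixUnit μ a c ∈ regionAlgebra b := by
  classical
  rw [S.mem_regionAlgebra]
  -- Comparing pairs in the sigma type avoids transporting indices along `ν = μ`.
  refine ⟨fun ν => Matrix.of fun x y => if (⟨ν, x⟩ : Σ ν, Fin (S.k ν)) = ⟨μ, a⟩ ∧
    (⟨ν, y⟩ : Σ ν, Fin (S.k ν)) = ⟨μ, c⟩ then 1 else 0, fun ν x x' => ?_⟩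
  by_cases h : ν = μ
  · subst h
    rw [matrixUnit_e]
    by_cases hc : c = x
    · subst hc
      simp
    · have : ¬ x = c := fun h => hc h.symm
      simp [hc, this]
  · rw [matrixUnit_apply, coeff_e_of_ne _ (Ne.symm h)]
    simp [h]

theorem matrixUnit'_mem (μ : Irrep G) (a' c' : Fin (S.k' μ)) :
    S.matrixUnit' μ a' c' ∈ regionAlgebra bᶜ := by
  classical
  rw [S.mem_regionAlgebra_compl]
  refine ⟨fun ν => Matrix.of fun x y => if (⟨ν, x⟩ : Σ ν, Fin (S.k' ν)) = ⟨μ, a'⟩ ∧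
    (⟨ν, y⟩ : Σ ν, Fin (S.k' ν)) = ⟨μ, c'⟩ then 1 else 0, fun ν x x' => ?_⟩
  by_cases h : ν = μ
  · subst h
    rw [matrixUnit'_e]
    by_cases hc : c' = x'
    · subst hc
      simp
    · have : ¬ x' = c' := fun h => hc h.symm
      simp [hc, this]
  · rw [matrixUnit'_apply, coeff_e_of_ne _ (Ne.symm h)]
    simp [h]

theorem matrixUnit_mul (μ : Irrep G) (a c x y : Fin (S.k μ)) :
    S.matrixUnit μ a c * S.matrixUnit μ x y = if c = x then S.matrixUnit μ a y else 0 := by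
  apply LinearMap.ext
  intro ψ
  rw [Module.End.mul_apply, S.matrixUnit_apply μ x y, map_sum]
  simp only [map_smul, matrixUnit_e]
  split_ifs with h
  · rw [matrixUnit_apply]
  · simp

theorem flux_matrixUnit (μ : Irrep G) (a c : Fin (S.k μ)) (ψ : physical G m) :
    flux b μ (S.matrixUnit μ a c ψ) = S.matrixUnit μ a c ψ := by
  rw [matrixUnit_apply, map_sum]
  simp only [map_smul, flux_e]

/-- On `P_μ` the operator is a rank-one projection, and elements of `A_b` act on `P_μ` alone. -/
theorem matrixUnit_minimal (μ : Irrep G) (a : Fin (S.k μ)) {X : Module.End ℂ (physical G m)}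
    (hX : X ∈ regionAlgebra b) :
    ∃ c : ℂ, S.matrixUnit μ a a * X * S.matrixUnit μ a a = c • S.matrixUnit μ a a := by
  obtain ⟨Y, hY⟩ := (S.mem_regionAlgebra X).1 hX
  refine ⟨Y μ a a, ?_⟩
  apply LinearMap.ext
  intro ψ
  rw [Module.End.mul_apply, Module.End.mul_apply, LinearMap.smul_apply, S.matrixUnit_apply μ a a ψ,
    map_sum, map_sum, Finset.smul_sum]
  refine Finset.sum_congr rfl fun a' _ => ?_
  rw [map_smul, map_smul, hY, map_sum, smul_comm]
  congr 1
  simp [matrixUnit_e]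

theorem inner_matrixUnit (ψ : physical G m) (μ : Irrep G) (a c : Fin (S.k μ)) :
    inner ℂ ψ (S.matrixUnit μ a c ψ) = (S.coeff ψ μ * (S.coeff ψ μ)ᴴ) c a := by
  rw [matrixUnit_apply, inner_sum, Matrix.mul_apply]
  refine Finset.sum_congr rfl fun a' _ => ?_
  rw [physical_inner_smul_right, ← inner_conj_symm]
  rfl

theorem inner_flux_eq_trace (ψ : physical G m) (μ : Irrep G) :
    inner ℂ ψ (flux b μ ψ) = (S.coeff ψ μ * (S.coeff ψ μ)ᴴ).trace := by
  rw [S.flux_eq_sum, inner_sum, Matrix.trace]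
  refine Finset.sum_congr rfl fun a _ => ?_
  rw [inner_sum, Matrix.diag, Matrix.mul_apply]
  refine Finset.sum_congr rfl fun a' _ => ?_
  rw [physical_inner_smul_right, ← inner_conj_symm]
  rfl

theorem nonempty_index [DecidableEq G] {ψ : physical G m} (hψ : IsMaximallyMixed b ψ)
    (hb : b.Nonempty) (μ : Irrep G) : Nonempty (Fin (S.k μ) × Fin (S.k' μ)) := by
  by_contra h
  rw [not_nonempty_iff] at h
  have h1 := hψ.inner_flux hb μ
  rw [S.flux_eq_sum, ← Fintype.sum_prod_type', Finset.univ_eq_empty, Finset.sum_empty,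
    inner_zero_right] at h1
  exact div_ne_zero (pow_ne_zero 2 μ.dim_ne_zero) Irrep.card_ne_zero h1.symm

open scoped ComplexOrder in
/-- In a state which is maximally mixed on `b`, the state of every `P_μ` is maximally mixed. -/
theorem coeff_mul_conjTranspose [DecidableEq G] {ψ : physical G m} (hψ : IsMaximallyMixed b ψ)
    (hb : b.Nonempty) (μ : Irrep G) :
    S.coeff ψ μ * (S.coeff ψ μ)ᴴ = ((μ.dim : ℂ) / Fintype.card (b → G)) • 1 := by
  classical
  -- Since `ψ` is separating, these matrices satisfy the matrix unit relations. Their expectations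
  -- in `ψ`, which are their normalized traces, are the entries to be computed.
  choose A hA using fun a c => exists_actsAs (S.matrixUnit_mem μ a c)
  have hA_mul : ∀ a c x y, A a c * A x y = if c = x then A a y else 0 := by
    intro a c x y
    apply hψ.actsAs_ext ((hA a c).mul (hA x y)) (X' := if c = x then S.matrixUnit μ a y else 0)
    · split_ifs
      · exact hA a y
      · intro φ
        simp [physMatrix]
    · rw [matrixUnit_mul]
  have hentry : ∀ a c, (S.coeff ψ μ * (S.coeff ψ μ)ᴴ) c a =
      (Fintype.card (b → G) : ℂ)⁻¹ * (A a c).trace := fun a c => by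
    rw [← inner_matrixUnit, hψ.inner_eq (hA a c)]
  ext c a
  rw [hentry, Matrix.smul_apply, Matrix.one_apply]
  split_ifs with hac
  · subst hac
    have hne : (A c c).trace ≠ 0 := by
      intro h0
      have h1 := hentry c c
      rw [h0, mul_zero, Matrix.mul_apply] at h1
      simp only [Matrix.conjTranspose_apply] at h1
      rw [Finset.sum_eq_zero_iff_of_nonneg fun i _ => mul_star_self_nonneg _] at h1
      have h2 : S.matrixUnit μ c c ψ = 0 := by
        rw [matrixUnit_apply]
        refine Finset.sum_eq_zero fun a' ha' => ?_
        have h3 := h1 a' ha'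
        rw [mul_eq_zero, star_eq_zero, or_self] at h3
        rw [h3, zero_smul]
      have h3 : A c c = 0 := by
        apply hψ.cancel
        rw [← hA, h2]
        simp [physMatrix]
      obtain ⟨-, a'⟩ := S.nonempty_index hψ hb μ
      have h4 := hA c c (S.e μ (c, a'))
      rw [h3, Matrix.zero_mul, matrixUnit_e, if_pos rfl] at h4
      have h5 : S.e μ (c, a') = 0 := physMatrix_injective b (by rw [h4]; simp [physMatrix])
      exact (S.orthonormal μ).ne_zero _ h5
    have hsq := trace_minimal (shiftMatrix b) μ (A c c) (hψ.commute (hA c c))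
      (by rw [hA_mul, if_pos rfl])
      (by
        apply hψ.cancel
        rw [Matrix.mul_assoc, ← hA, ← physMatrix_flux, flux_matrixUnit])
      (by
        intro Z hZ
        obtain ⟨X, hX, hXZ⟩ := exists_mem_regionAlgebra b Z hZ
        obtain ⟨r, hr⟩ := S.matrixUnit_minimal μ c hX
        refine ⟨r, hψ.actsAs_ext (((hA c c).mul hXZ).mul (hA c c))
          (X' := r • S.matrixUnit μ c c) (fun φ => ?_) (by rw [hr])⟩
        rw [Matrix.smul_mul, ← hA]
        simp [physMatrix])
      hne
    -- `trace_minimal` fixes the trace up to sign; the sign is decided by positivity of the diagonal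
    -- entry.
    have htr : (A c c).trace = μ.dim := by
      rcases sq_eq_sq_iff_eq_or_eq_neg.1 hsq with h | h
      · exact h
      · exfalso
        have h1 := hentry c c
        have h2 : 0 ≤ (S.coeff ψ μ * (S.coeff ψ μ)ᴴ) c c := by
          rw [Matrix.mul_apply]
          exact Finset.sum_nonneg fun i _ => mul_star_self_nonneg _
        rw [h1, h] at h2
        have h3 : ((Fintype.card (b → G) : ℂ)⁻¹ * -(μ.dim : ℂ)) =
            (((Fintype.card (b → G) : ℝ)⁻¹ * -(μ.dim : ℝ) : ℝ) : ℂ) := by push_cast; rfl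
        rw [h3, Complex.zero_le_real] at h2
        have h4 : (0 : ℝ) < (Fintype.card (b → G) : ℝ)⁻¹ * μ.dim := by
          have := μ.dim_pos
          positivity
        linarith
    rw [htr, smul_eq_mul, mul_one, div_eq_inv_mul]
  · have h1 : (A a c).trace = 0 := by
      -- Cyclicity of the trace turns this product into `A a c * A a a`, which is zero for `c ≠ a`.
      have h2 : A a c = A a a * A a c := by rw [hA_mul, if_pos rfl]
      rw [h2, Matrix.trace_mul_comm, hA_mul, if_neg hac, Matrix.trace_zero]
    rw [h1, mul_zero, smul_zero]

theorem k_eq [DecidableEq G] {ψ : physical G m} (hψ : IsMaximallyMixed b ψ) (hb : b.Nonempty) (μ : Irrep G) :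
    (S.k μ : ℂ) * Fintype.card G = μ.dim * Fintype.card (b → G) := by
  classical
  have hN : (Fintype.card (b → G) : ℂ) ≠ 0 := by simp
  have hn := Irrep.card_ne_zero (G := G)
  have hd := μ.dim_ne_zero
  have h := hψ.inner_flux hb μ
  rw [S.inner_flux_eq_trace, S.coeff_mul_conjTranspose hψ hb, Matrix.trace_smul,
    Matrix.trace_one, Fintype.card_fin, smul_eq_mul] at h
  field_simp at h
  exact h

/-- In a state which is a product for the bipartition `b | bᶜ`, the state of every `P_μ ⊗ P'_μ`
is a product. -/
theorem exists_coeff_eq_mul {ψ : physical G m} {u : (b → G) → ℂ} {v : (↥bᶜ → G) → ℂ}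
    (hψ : physMatrix b ψ = Matrix.vecMulVec u v) (μ : Irrep G) :
    ∃ (x : Fin (S.k μ) → ℂ) (y : Fin (S.k' μ) → ℂ), ∀ a a', S.coeff ψ μ a a' = x a * y a' := by
  classical
  by_cases h0 : ∀ a a', S.coeff ψ μ a a' = 0
  · exact ⟨0, 0, fun a a' => by simp [h0]⟩
  push Not at h0
  obtain ⟨c, a', hca⟩ := h0
  choose A hA using fun a => exists_actsAs (S.matrixUnit_mem μ a c)
  choose A' hA' using fun c' => exists_actsAs_compl (S.matrixUnit'_mem μ a' c')
  -- The nonzero entry `(c, a')` is a pivot. The two matrix units act on opposite sides of the cut,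
  -- so the inner product of their images of `u ⊗ v` separates into a function of `a` and a function
  -- of `c'`.
  have key : ∀ a c', star (S.coeff ψ μ c a') * S.coeff ψ μ a c' =
      (u ⬝ᵥ star (A a *ᵥ u)) * ((A' c' *ᵥ v) ⬝ᵥ star v) := by
    intro a c'
    have h1 : inner ℂ (S.matrixUnit μ a c ψ) (S.matrixUnit' μ a' c' ψ) =
        star (S.coeff ψ μ c a') * S.coeff ψ μ a c' := by
      have horth := orthonormal_iff_ite.1 (S.orthonormal μ)
      rw [matrixUnit_apply, matrixUnit'_apply, sum_inner, Finset.sum_eq_single a', inner_sum,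
        Finset.sum_eq_single a]
      · rw [physical_inner_smul_left, physical_inner_smul_right]
        rw [horth]
        simp
      · intro x _ hx
        rw [physical_inner_smul_left, physical_inner_smul_right]
        rw [horth]
        simp [hx.symm]
      · simp
      · intro x' _ hx'
        rw [inner_sum]
        refine Finset.sum_eq_zero fun x _ => ?_
        rw [physical_inner_smul_left, physical_inner_smul_right]
        rw [horth]
        simp [hx']
      · simp
    rw [← h1, inner_eq_trace_physMatrix b, hA, hA', hψ, Matrix.mul_vecMulVec,
      Matrix.vecMulVec_mul, Matrix.vecMul_transpose, Matrix.conjTranspose_vecMulVec,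
      Matrix.vecMulVec_mul_vecMulVec, Matrix.trace_vecMulVec, dotProduct_smul, smul_eq_mul,
      mul_comm]
  refine ⟨fun a => (star (S.coeff ψ μ c a'))⁻¹ * (u ⬝ᵥ star (A a *ᵥ u)),
    fun c' => (A' c' *ᵥ v) ⬝ᵥ star v, fun a c' => ?_⟩
  rw [mul_assoc, ← key, inv_mul_cancel_left₀]
  simpa using hca

end SectorSplitting

/-! ### The reference state -/

section ReferenceState

variable {G : Type*} [Group G] [Fintype G] [DecidableEq G] {m : ℕ}

/-- The configuration with the value `q.1` on the links in `p` and `q.2` on the other links. -/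
def twoValued {L : Type*} (p : L → Prop) [DecidablePred p] (q : G × G) : L → G :=
  fun ℓ => if p ℓ then q.1 else q.2

/-- The product of the invariant states `∑_s |s, …, s⟩` of `p` and of `pᶜ`. -/
def referenceVec (G : Type*) [Group G] [Fintype G] [DecidableEq G] (p : Finset (Fin m)) :
    LinkSpace m G :=
  WithLp.toLp 2 fun g => (Fintype.card G : ℂ)⁻¹ *
    ∑ q : G × G, if g = twoValued (· ∈ p) q then 1 else 0

theorem referenceVec_apply (p : Finset (Fin m)) (g : Fin m → G) :
    referenceVec G p g = (Fintype.card G : ℂ)⁻¹ *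
      ∑ q : G × G, if g = twoValued (· ∈ p) q then 1 else 0 := rfl

theorem shift_univ_referenceVec (p : Finset (Fin m)) (h : G) :
    shift Finset.univ h (referenceVec G p) = referenceVec G p := by
  ext g
  simp only [shift, LinearMap.coe_mk, AddHom.coe_mk, referenceVec_apply, Finset.mem_univ, if_true]
  congr 1
  refine Fintype.sum_equiv ((Equiv.mulLeft h).prodCongr (Equiv.mulLeft h)) _ _ fun q => ?_
  refine if_congr ?_ rfl rfl
  simp only [funext_iff, twoValued, Equiv.prodCongr_apply, Prod.map, Equiv.coe_mulLeft]
  refine forall_congr' fun ℓ => ?_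
  split_ifs <;> exact inv_mul_eq_iff_eq_mul

theorem shift_referenceVec (p : Finset (Fin m)) (h : G) :
    shift p h (referenceVec G p) = referenceVec G p := by
  ext g
  simp only [shift, LinearMap.coe_mk, AddHom.coe_mk, referenceVec_apply]
  congr 1
  refine Fintype.sum_equiv ((Equiv.mulLeft h).prodCongr (Equiv.refl G)) _ _ fun q => ?_
  refine if_congr ?_ rfl rfl
  simp only [funext_iff, twoValued, Equiv.prodCongr_apply, Prod.map, Equiv.coe_mulLeft,
    Equiv.refl_apply]
  refine forall_congr' fun ℓ => ?_
  split_ifs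
  · exact inv_mul_eq_iff_eq_mul
  · rfl

/-- The reference state as a physical state. -/
def referenceState (G : Type*) [Group G] [Fintype G] [DecidableEq G] (p : Finset (Fin m)) :
    physical G m :=
  ⟨referenceVec G p, mem_physical_of_shift_univ_eq (shift_univ_referenceVec p)⟩

/-- The matrix with entries `1` at `(x, q)` for `x` two-valued with values `q`. -/
def twoValuedMatrix (G : Type*) [Group G] [DecidableEq G] {L : Type*} [Fintype L] (p : L → Prop)
    [DecidablePred p] : Matrix (L → G) (G × G) ℂ :=
  Matrix.of fun x q => if x = twoValued p q then 1 else 0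

omit [Fintype G] [DecidableEq G] [Group G] in
theorem glue_eq_twoValued_iff (b p : Finset (Fin m)) (x : b → G) (z : ↥bᶜ → G) (q : G × G) :
    glue b x z = twoValued (· ∈ p) q ↔
      x = twoValued (fun ℓ : b => (ℓ : Fin m) ∈ p) q ∧
        z = twoValued (fun ℓ : ↥bᶜ => (ℓ : Fin m) ∈ p) q := by
  constructor
  · intro h
    exact ⟨by rw [← glue_left b x z, h]; rfl, by rw [← glue_right b x z, h]; rfl⟩
  · rintro ⟨rfl, rfl⟩
    exact glue_restrict b (twoValued (· ∈ p) q)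

theorem physMatrix_referenceState (b p : Finset (Fin m)) :
    physMatrix b (referenceState G p) = (Fintype.card G : ℂ)⁻¹ •
      (twoValuedMatrix G (fun ℓ : b => (ℓ : Fin m) ∈ p) *
        (twoValuedMatrix G (fun ℓ : ↥bᶜ => (ℓ : Fin m) ∈ p))ᵀ) := by
  ext x z
  change referenceVec G p (glue b x z) = _
  rw [referenceVec_apply, Matrix.smul_apply, Matrix.mul_apply, smul_eq_mul]
  congr 1
  refine Finset.sum_congr rfl fun q _ => ?_
  simp only [glue_eq_twoValued_iff, twoValuedMatrix, Matrix.transpose_apply, Matrix.of_apply]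
  rw [ite_and, ite_mul, one_mul, zero_mul]

/-- Outside `b` the links `i` and `j` record both values, so tracing out `bᶜ` leaves the uniform
mixture of the pairs `q`. It is maximally mixed when every configuration of `b` comes from the same
number `N` of pairs. -/
theorem isMaximallyMixed_referenceState {b p : Finset (Fin m)} {i j : Fin m} (hi : i ∈ p)
    (hib : i ∉ b) (hj : j ∉ p) (hjb : j ∉ b) (N : ℕ)
    (hN : ∀ x : b → G, (Finset.univ.filter fun q : G × G =>
      x = twoValued (fun ℓ : b => (ℓ : Fin m) ∈ p) q).card = N)
    (hcard : N * Fintype.card (b → G) = Fintype.card G ^ 2) :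
    IsMaximallyMixed b (referenceState G p) := by
  have hn := Irrep.card_ne_zero (G := G)
  have hQ : (twoValuedMatrix G (fun ℓ : ↥bᶜ => (ℓ : Fin m) ∈ p))ᵀ *
      ((twoValuedMatrix G (fun ℓ : ↥bᶜ => (ℓ : Fin m) ∈ p))ᵀ)ᴴ = 1 := by
    ext q r
    rw [Matrix.mul_apply, Finset.sum_eq_single (twoValued (fun ℓ : ↥bᶜ => (ℓ : Fin m) ∈ p) q)]
    · simp only [twoValuedMatrix, Matrix.transpose_apply, Matrix.of_apply, if_true, one_mul,
        Matrix.conjTranspose_apply, Matrix.one_apply]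
      have : twoValued (fun ℓ : ↥bᶜ => (ℓ : Fin m) ∈ p) q =
          twoValued (fun ℓ : ↥bᶜ => (ℓ : Fin m) ∈ p) r ↔ q = r := by
        constructor
        · intro h
          have h1 := congrFun h ⟨i, Finset.mem_compl.2 hib⟩
          have h2 := congrFun h ⟨j, Finset.mem_compl.2 hjb⟩
          simp only [twoValued, hi, hj, if_true, if_false] at h1 h2
          exact Prod.ext h1 h2
        · rintro rfl; rfl
      simp only [this]
      split_ifs <;> simp
    · intro z _ hz
      simp [twoValuedMatrix, hz]
    · simp
  have hP : twoValuedMatrix G (fun ℓ : b => (ℓ : Fin m) ∈ p) *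
      (twoValuedMatrix G (fun ℓ : b => (ℓ : Fin m) ∈ p))ᴴ = (N : ℂ) • 1 := by
    ext x y
    rw [Matrix.mul_apply, Matrix.smul_apply, Matrix.one_apply]
    split_ifs with hxy
    · subst hxy
      rw [← hN x, Finset.card_filter]
      simp only [twoValuedMatrix, Matrix.of_apply, Matrix.conjTranspose_apply]
      push_cast
      rw [smul_eq_mul, mul_one]
      refine Finset.sum_congr rfl fun q _ => ?_
      split_ifs <;> simp
    · rw [smul_zero]
      refine Finset.sum_eq_zero fun q _ => ?_
      simp only [twoValuedMatrix, Matrix.of_apply, Matrix.conjTranspose_apply]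
      split_ifs with h1 h2
      · exact absurd (h1.trans h2.symm) hxy
      · simp
      · simp
      · simp
  rw [IsMaximallyMixed, physMatrix_referenceState, Matrix.conjTranspose_smul, Matrix.smul_mul,
    Matrix.mul_smul, Matrix.conjTranspose_mul, Matrix.mul_assoc,
    ← Matrix.mul_assoc _ _ (twoValuedMatrix G (fun ℓ : b => (ℓ : Fin m) ∈ p))ᴴ, hQ,
    Matrix.one_mul, hP, smul_smul, smul_smul]
  congr 1
  have hc : (Fintype.card (b → G) : ℂ) ≠ 0 := by simp
  have hcard' : (N : ℂ) * Fintype.card (b → G) = (Fintype.card G : ℂ) ^ 2 := by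
    exact_mod_cast hcard
  simp only [star_inv₀, star_natCast]
  field_simp
  exact hcard'

theorem isMaximallyMixed_singleton_left {p : Finset (Fin m)} {i i' j : Fin m} (hi : i ∈ p)
    (hi' : i' ∈ p) (hii' : i' ≠ i) (hj : j ∉ p) :
    IsMaximallyMixed {i} (referenceState G p) := by
  refine isMaximallyMixed_referenceState hi' (by simpa using hii') hj
    (by rintro h; rw [Finset.mem_singleton] at h; exact hj (h ▸ hi)) (Fintype.card G)
    (fun x => ?_) (by simp [sq])
  have : (Finset.univ.filter fun q : G × G =>
      x = twoValued (fun ℓ : ({i} : Finset (Fin m)) => (ℓ : Fin m) ∈ p) q) =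
      {x ⟨i, by simp⟩} ×ˢ Finset.univ := by
    ext q
    simp only [Finset.mem_filter, Finset.mem_univ, true_and, Finset.mem_product,
      Finset.mem_singleton, and_true]
    constructor
    · intro h
      rw [h]
      simp [twoValued, hi]
    · intro h
      funext ⟨ℓ, hℓ⟩
      rw [Finset.mem_singleton] at hℓ
      subst hℓ
      simp [twoValued, hi, h]
  rw [this]
  simp

theorem isMaximallyMixed_singleton_right {p : Finset (Fin m)} {i j j' : Fin m} (hi : i ∈ p)
    (hj : j ∉ p) (hj' : j' ∉ p) (hjj' : j' ≠ j) :
    IsMaximallyMixed {j} (referenceState G p) := by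
  refine isMaximallyMixed_referenceState hi
    (by rintro h; rw [Finset.mem_singleton] at h; exact hj (h ▸ hi)) hj'
    (by simpa using hjj') (Fintype.card G) (fun x => ?_) (by simp [sq])
  have : (Finset.univ.filter fun q : G × G =>
      x = twoValued (fun ℓ : ({j} : Finset (Fin m)) => (ℓ : Fin m) ∈ p) q) =
      Finset.univ ×ˢ {x ⟨j, by simp⟩} := by
    ext q
    simp only [Finset.mem_filter, Finset.mem_univ, true_and, Finset.mem_product,
      Finset.mem_singleton]
    constructor
    · intro h
      rw [h]
      simp [twoValued, hj]
    · intro h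
      funext ⟨ℓ, hℓ⟩
      rw [Finset.mem_singleton] at hℓ
      subst hℓ
      simp [twoValued, hj, h]
  rw [this]
  simp

omit [Group G] [DecidableEq G] in
theorem card_pair_fun {i j : Fin m} (h : i ≠ j) :
    Fintype.card (({i} ∪ {j} : Finset (Fin m)) → G) = Fintype.card G ^ 2 := by
  rw [Fintype.card_fun, Fintype.card_coe,
    Finset.card_union_of_disjoint (Finset.disjoint_singleton.2 h)]
  simp

theorem isMaximallyMixed_pair {p : Finset (Fin m)} {i i' j j' : Fin m} (hi : i ∈ p)
    (hi' : i' ∈ p) (hii' : i' ≠ i) (hj : j ∉ p) (hj' : j' ∉ p) (hjj' : j' ≠ j) :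
    IsMaximallyMixed ({i} ∪ {j}) (referenceState G p) := by
  have hne : i ≠ j := fun h => hj (h ▸ hi)
  refine isMaximallyMixed_referenceState hi' (i := i') (j := j') ?_ hj' ?_ 1
    (fun x => ?_) ?_
  · have : i' ≠ j := fun h => hj (h ▸ hi')
    simp [hii', this]
  · have : j' ≠ i := fun h => hj' (h ▸ hi)
    simp [hjj', this]
  · have : (Finset.univ.filter fun q : G × G =>
        x = twoValued (fun ℓ : ({i} ∪ {j} : Finset (Fin m)) => (ℓ : Fin m) ∈ p) q) =
        {(x ⟨i, by simp⟩, x ⟨j, by simp⟩)} := by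
      ext q
      simp only [Finset.mem_filter, Finset.mem_univ, true_and, Finset.mem_singleton]
      constructor
      · intro h
        rw [h]
        simp [twoValued, hi, hj]
      · intro h
        funext ⟨ℓ, hℓ⟩
        rw [Finset.mem_union, Finset.mem_singleton, Finset.mem_singleton] at hℓ
        rcases hℓ with rfl | rfl
        · simp [twoValued, hi, h]
        · simp [twoValued, hj, h]
    rw [this]
    simp
  · rw [one_mul, card_pair_fun hne]

theorem physMatrix_referenceState_self (p : Finset (Fin m)) :
    ∃ (u : (p → G) → ℂ) (v : (↥pᶜ → G) → ℂ),
      physMatrix p (referenceState G p) = Matrix.vecMulVec u v := by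
  let u : (p → G) → ℂ := fun x => ∑ s, if x = fun _ => s then 1 else 0
  let v : (↥pᶜ → G) → ℂ := fun z => ∑ t, if z = fun _ => t then 1 else 0
  refine ⟨(Fintype.card G : ℂ)⁻¹ • u, v, ?_⟩
  rw [physMatrix_referenceState, Matrix.smul_vecMulVec]
  congr 1
  ext x z
  rw [Matrix.mul_apply, Matrix.vecMulVec_apply]
  simp only [u, v]
  rw [Finset.sum_mul_sum, Fintype.sum_prod_type]
  refine Finset.sum_congr rfl fun s _ => Finset.sum_congr rfl fun t _ => ?_
  have h1 : twoValued (fun ℓ : p => (ℓ : Fin m) ∈ p) (s, t) = fun _ => s := by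
    funext ℓ; simp [twoValued]
  have h2 : twoValued (fun ℓ : ↥pᶜ => (ℓ : Fin m) ∈ p) (s, t) = fun _ => t := by
    funext ℓ
    have := Finset.mem_compl.1 ℓ.2
    simp [twoValued, this]
  simp only [twoValuedMatrix, Matrix.of_apply, Matrix.transpose_apply, h1, h2]

/-- The state is invariant under translations of `p`, so the flux projector reduces to the sum of a
nontrivial character. -/
theorem flux_referenceState {p : Finset (Fin m)} {ν : Irrep G} (hν : ν ≠ Irrep.one G) :
    flux p ν (referenceState G p) = 0 := by
  classical
  apply Subtype.ext
  change fluxPre p ν (referenceVec G p) = 0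
  have h := Irrep.sum_character_mul_inv ν (Irrep.one G)
  simp only [Irrep.character_trivial, mul_one, if_neg hν] at h
  simp only [fluxPre, LinearMap.smul_apply, LinearMap.sum_apply, shift_referenceVec]
  rw [← Finset.sum_smul, h, zero_smul, smul_zero]

end ReferenceState

/-! ### Comparison of the cuts -/

section Main

variable {G : Type*} [Group G] [Fintype G] {m : ℕ} {κ : Type*} [Fintype κ]
  {α β : Irrep G → Type*} [∀ μ, Fintype (α μ)] [∀ μ, Fintype (β μ)]
  {χ : (μ : Irrep G) → EuclideanSpace ℂ (α μ × β μ)}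
  {J : physical G m →ₗᵢ[ℂ] LinkSpace m κ}

theorem HasEdgeModes.exists_eq_edgeVec {b : Finset (Fin m)} (h : HasEdgeModes J b χ) :
    ∃ (S : SectorSplitting G b) (w : (Σ μ : Irrep G, Fin (S.k μ) × α μ) → RegionSpace b κ)
      (w' : (Σ μ : Irrep G, Fin (S.k' μ) × β μ) → RegionSpace bᶜ κ),
      Orthonormal ℂ w ∧ Orthonormal ℂ w' ∧ ∀ ψ, J ψ = edgeVec w w' (S.coeff ψ) χ := by
  obtain ⟨S, w, w', hw, hw', hJ⟩ := h
  refine ⟨S, w, w', hw, hw', fun ψ => ?_⟩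
  rw [hJ, edgeVec]
  refine Finset.sum_congr rfl fun μ _ => Finset.sum_congr rfl fun a _ =>
    Finset.sum_congr rfl fun a' _ => ?_
  exact congrArg (· • _) (S.inner_e_flux μ (a, a') ψ)

theorem inner_map_eq (b : Finset (Fin m)) (φ : physical G m) :
    (bipartite b (J φ) * (bipartite b (J φ))ᴴ).trace = inner ℂ φ φ := by
  rw [← inner_eq_trace, inner_self_eq_norm_sq_to_K, J.norm_map]
  exact (inner_self_eq_norm_sq_to_K (𝕜 := ℂ) φ).symm

variable [DecidableEq G]

theorem inner_self_of_isMaximallyMixed {b : Finset (Fin m)} {ψ : physical G m}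
    (hψ : IsMaximallyMixed b ψ) : inner ℂ ψ ψ = (1 : ℂ) := by
  rw [inner_eq_trace_physMatrix b, hψ, Matrix.trace_smul, Matrix.trace_one, smul_eq_mul,
    inv_mul_cancel₀ (by simp)]

/-- With `N = |G|^|b|`, the block of `μ` has multiplicity `k_μ = d_μ N / |G|` and weight `c_μ = d_μ
/ N`. After the rescaling, the right-hand sides no longer depend on `b`, `ψ` or the chosen
splitting. -/
theorem moments_of_isMaximallyMixed {b : Finset (Fin m)} (hb : b.Nonempty)
    (h : HasEdgeModes J b χ) {ψ : physical G m} (hψ : IsMaximallyMixed b ψ) :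
    (∑ μ : Irrep G, (μ.dim : ℂ) ^ 2 *
        (coeffMatrix (χ μ) * (coeffMatrix (χ μ))ᴴ).trace = Fintype.card G) ∧
    (secondMoment (· ∈ b) (J ψ) * (Fintype.card G * Fintype.card (b → G)) =
      ∑ μ : Irrep G, (μ.dim : ℂ) ^ 3 * (coeffMatrix (χ μ) * (coeffMatrix (χ μ))ᴴ *
        (coeffMatrix (χ μ) * (coeffMatrix (χ μ))ᴴ)).trace) ∧
    (thirdMoment (· ∈ b) (J ψ) * (Fintype.card G * Fintype.card (b → G) ^ 2) =
      ∑ μ : Irrep G, (μ.dim : ℂ) ^ 4 * (coeffMatrix (χ μ) * (coeffMatrix (χ μ))ᴴ *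
        (coeffMatrix (χ μ) * (coeffMatrix (χ μ))ᴴ) *
        (coeffMatrix (χ μ) * (coeffMatrix (χ μ))ᴴ)).trace) := by
  have hn := Irrep.card_ne_zero (G := G)
  have hN : (Fintype.card (b → G) : ℂ) ≠ 0 := by simp
  obtain ⟨S, w, w', hw, hw', hJ⟩ := h.exists_eq_edgeVec
  have hC := S.coeff_mul_conjTranspose hψ hb
  have hk : ∀ μ, (S.k μ : ℂ) = μ.dim * Fintype.card (b → G) / Fintype.card G := fun μ => by
    rw [eq_div_iff hn, S.k_eq hψ hb]
  refine ⟨?_, ?_, ?_⟩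
  · have h1 := inner_map_eq (J := J) b ψ
    rw [inner_self_of_isMaximallyMixed hψ, hJ, trace_reduced_edgeVec hw hw'] at h1
    have h2 := congrArg (· * (Fintype.card G : ℂ)) h1
    simp only [one_mul] at h2
    rw [← h2, Finset.sum_mul]
    refine Finset.sum_congr rfl fun μ _ => ?_
    rw [hC, Matrix.trace_smul, Matrix.trace_one, Fintype.card_fin, hk, smul_eq_mul]
    field_simp
  · rw [hJ, secondMoment_edgeVec hw hw' _ _ _ hC, Finset.sum_mul]
    refine Finset.sum_congr rfl fun μ _ => ?_
    rw [hk]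
    field_simp
  · rw [hJ, thirdMoment_edgeVec hw hw' _ _ _ hC, Finset.sum_mul]
    refine Finset.sum_congr rfl fun μ _ => ?_
    rw [hk]
    field_simp

/-- `J` preserves the norm of a basis vector of the sector `μ`, which exists because `ψ` has nonzero
weight there. -/
theorem trace_eq_one_of_hasEdgeModes {b : Finset (Fin m)} (hb : b.Nonempty)
    (h : HasEdgeModes J b χ) {ψ : physical G m} (hψ : IsMaximallyMixed b ψ) (μ : Irrep G) :
    (coeffMatrix (χ μ) * (coeffMatrix (χ μ))ᴴ).trace = 1 := by
  classical
  obtain ⟨S, w, w', hw, hw', hJ⟩ := h.exists_eq_edgeVec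
  obtain ⟨a, a'⟩ : Nonempty (Fin (S.k μ) × Fin (S.k' μ)) := S.nonempty_index hψ hb μ
  have h1 := inner_map_eq (J := J) b (S.e μ (a, a'))
  have h2 : inner ℂ (S.e μ (a, a')) (S.e μ (a, a')) = (1 : ℂ) := by
    have h3 := S.coeff_e μ a a a' a'
    rw [if_pos ⟨rfl, rfl⟩] at h3
    exact h3
  rw [h2, hJ, trace_reduced_edgeVec hw hw', Finset.sum_eq_single μ] at h1
  · have h3 : (S.coeff (S.e μ (a, a')) μ * (S.coeff (S.e μ (a, a')) μ)ᴴ).trace = 1 := by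
      rw [← S.inner_flux_eq_trace, S.flux_e, h2]
    rwa [h3, one_mul] at h1
  · intro ν _ hν
    rw [S.coeff_e_of_ne hν]
    simp
  · simp

/-- Only the trivial sector contributes, and there both the state of `P_1 ⊗ P'_1` and `χ_1` are
products. -/
theorem exists_map_eq_tensorVec {p : Finset (Fin m)} (h : HasEdgeModes J p χ)
    (hχ : IsFactorized (χ (Irrep.one G))) :
    ∃ u v, J (referenceState G p) = tensorVec p u v := by
  classical
  obtain ⟨S, w, w', hw, hw', hJ⟩ := h.exists_eq_edgeVec
  obtain ⟨u₀, v₀, huv⟩ := physMatrix_referenceState_self (G := G) p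
  obtain ⟨x, y, hxy⟩ := S.exists_coeff_eq_mul huv (Irrep.one G)
  obtain ⟨s, t, hst⟩ := hχ
  refine ⟨∑ a, ∑ i, (x a * s i) • w ⟨Irrep.one G, a, i⟩,
    ∑ a', ∑ j, (y a' * t j) • w' ⟨Irrep.one G, a', j⟩, ?_⟩
  rw [hJ, edgeVec, Finset.sum_eq_single (Irrep.one G)]
  · apply bipartite_injective p
    ext g k
    simp only [map_sum, map_smul, bipartite_tensorVec, Matrix.sum_apply, Matrix.smul_apply,
      Matrix.vecMulVec_apply, WithLp.ofLp_sum, WithLp.ofLp_smul, Finset.sum_apply,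
      Pi.smul_apply, smul_eq_mul, hxy, hst]
    rw [Finset.sum_mul]
    refine Finset.sum_congr rfl fun a _ => ?_
    rw [Finset.sum_mul]
    simp only [Finset.mul_sum]
    rw [Finset.sum_comm]
    refine Finset.sum_congr rfl fun i _ => Finset.sum_congr rfl fun a' _ =>
      Finset.sum_congr rfl fun j _ => ?_
    ring
  · intro ν _ hν
    refine Finset.sum_eq_zero fun a _ => Finset.sum_eq_zero fun a' _ => ?_
    have : S.coeff (referenceState G p) ν a a' = 0 := by
      change inner ℂ (S.e ν (a, a')) (referenceState G p) = 0
      rw [← S.inner_e_flux, flux_referenceState hν, inner_zero_right]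
    rw [this, zero_smul]
  · simp

theorem sq_eq_mul_of_moments {A B S n N M : ℂ} (hA : A * N = S) (hB : B * N = S)
    (hAB : A * B * M = S) (hM : N * N = n * M) : S ^ 2 = n * S := by
  calc S ^ 2 = A * N * (B * N) := by rw [hA, hB, sq]
    _ = A * B * (N * N) := by ring
    _ = n * (A * B * M) := by rw [hM]; ring
    _ = n * S := by rw [hAB]

end Main

end

theorem mainTheorem1 {G : Type*} [Group G] [Fintype G] (m : ℕ) (hm : 4 ≤ m)
    {κ : Type*} [Fintype κ]
    {α β : Irrep G → Type*} [∀ μ, Fintype (α μ)] [∀ μ, Fintype (β μ)]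
    (χ : (μ : Irrep G) → EuclideanSpace ℂ (α μ × β μ))
    (J : physical G m →ₗᵢ[ℂ] LinkSpace m κ)
    (hJ : ∀ b : Finset (Fin m), b.Nonempty → bᶜ.Nonempty → HasEdgeModes J b χ)
    (hχ : IsFactorized (χ (Irrep.one G))) (μ : Irrep G) :
    IsMaximallyEntangledOfRank (χ μ) μ.dim := by
  classical
  let i : Fin m := ⟨0, by omega⟩
  let i' : Fin m := ⟨1, by omega⟩
  let j : Fin m := ⟨2, by omega⟩
  let j' : Fin m := ⟨3, by omega⟩
  -- Four links are needed: on each side of the cut, one link enters the region under study and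
  -- another stays in its complement.
  let p : Finset (Fin m) := {i, i'}
  have hi : i ∈ p := by simp [p]
  have hi' : i' ∈ p := by simp [p]
  have hj : j ∉ p := by simp [p, i, i', j]
  have hj' : j' ∉ p := by simp [p, i, i', j']
  have hii' : i' ≠ i := by simp [i, i']
  have hjj' : j' ≠ j := by simp [j, j']
  have mm₁ := isMaximallyMixed_singleton_left (G := G) hi hi' hii' hj
  have mm₂ := isMaximallyMixed_singleton_right (G := G) hi hj hj' hjj'
  have mm₃ := isMaximallyMixed_pair (G := G) hi hi' hii' hj hj' hjj'
  have ne₁ : ({i} : Finset (Fin m)).Nonempty := ⟨i, by simp⟩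
  have ne₂ : ({j} : Finset (Fin m)).Nonempty := ⟨j, by simp⟩
  have ne₃ : ({i} ∪ {j} : Finset (Fin m)).Nonempty := ⟨i, by simp⟩
  have em₁ := hJ {i} ne₁ ⟨j, by simp [i, j]⟩
  have em₂ := hJ {j} ne₂ ⟨i, by simp [i, j]⟩
  have em₃ := hJ ({i} ∪ {j}) ne₃ ⟨i', by simp [i, i', j]⟩
  obtain ⟨u, v, huv⟩ := exists_map_eq_tensorVec
    (hJ p ⟨i, hi⟩ ⟨j, Finset.mem_compl.2 hj⟩) hχ
  obtain ⟨h₁, h₂, h₃⟩ := moments_of_isMaximallyMixed ne₁ em₁ mm₁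
  obtain ⟨-, h₂', h₃'⟩ := moments_of_isMaximallyMixed ne₂ em₂ mm₂
  obtain ⟨-, h₂'', h₃''⟩ := moments_of_isMaximallyMixed ne₃ em₃ mm₃
  have hnorm : ‖tensorVec p u v‖ = 1 := by
    rw [← huv, J.norm_map]
    have h := inner_self_of_isMaximallyMixed mm₁
    rw [inner_self_eq_norm_sq_to_K] at h
    have h' : ‖referenceState G p‖ ^ 2 = 1 := by
      refine Complex.ofReal_injective ?_
      rw [Complex.ofReal_pow, Complex.ofReal_one]
      exact h
    exact (pow_eq_one_iff_of_nonneg (norm_nonneg _) two_ne_zero).1 h'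
  have hs₁ : {i} ⊆ p := by simpa using hi
  have hs₂ : {j} ⊆ pᶜ := by simpa using hj
  have u₂ := secondMoment_union hs₁ hs₂ u v hnorm
  have u₃ := thirdMoment_union hs₁ hs₂ u v hnorm
  rw [← huv] at u₂ u₃
  have hn := Irrep.card_ne_zero (G := G)
  have hij : i ≠ j := by simp [i, j]
  have c₁ : (Fintype.card (({i} : Finset (Fin m)) → G) : ℂ) = Fintype.card G := by simp
  have c₂ : (Fintype.card (({j} : Finset (Fin m)) → G) : ℂ) = Fintype.card G := by simp
  have c₃ : (Fintype.card (({i} ∪ {j} : Finset (Fin m)) → G) : ℂ) =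
      (Fintype.card G : ℂ) ^ 2 := by
    exact_mod_cast card_pair_fun hij
  rw [c₁] at h₂ h₃
  rw [c₂] at h₂' h₃'
  rw [c₃, u₂] at h₂''
  rw [c₃, u₃] at h₃''
  refine isMaximallyEntangledOfRank_of_flat _ _
    (flat_of_moments (fun μ : Irrep G => μ.dim) (fun μ => μ.dim_pos.ne')
      (fun μ => coeffMatrix (χ μ)) _ hn h₁ ?_ ?_ μ)
    (trace_eq_one_of_hasEdgeModes ne₁ em₁ mm₁ μ)
  · exact sq_eq_mul_of_moments h₂ h₂' h₂'' (by ring)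
  · exact sq_eq_mul_of_moments h₃ h₃' h₃'' (by ring)
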